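/- Let $X$ be a compact Hausdorff space, let $h\colon X\to X$ be a minimal homeomorphism, let $D$ be a unital C*-algebra, and let $\alpha\in\mathrm{Aut}(C(X,D))$ lie over $h$, that is, for all $n\in\mathbb Z$ and $x\in X$ there is $\alpha_{n,x}\in\mathrm{Aut}(D)$ such that $\alpha^n(a)(x)=\alpha_{n,x}(a(h^{-n}(x)))$ for all $a\in C(X,D)$. Let $u$ be the canonical unitary of the crossed product $C^*(\mathbb Z,C(X,D),\alpha)$, so that $uau^*=\alpha(a)$ for $a\in C(X,D)$. Let $Y\subset X$ be closed with $\mathrm{int}(Y)\neq\varnothing$, and let $$A_Y=C^*(\mathbb Z,C(X,D),\alpha)_Y\subset C^*(\mathbb Z,C(X,D),\alpha)$$ be the C*-subalgebra generated by $C(X,D)$ and $\{fu : f\in C(X,D),\ f|_Y=0\}$. For $y\in Y$ put $r(y)=\inf\{m\ge1: h^m(y)\in Y\}$. For $m\ge0$ put $Z_m=\bigcup_{j=0}^{m-1}h^j(Y)$. Then $r$ is finite on $Y$ and takes only finitely many values $n(0)<n(1)<\dots<n(l)$. For $0\le k\le l$ let $Y_k=\overline{\{y\in Y: r(y)=n(k)\}}$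 and $Y_k^\circ=\mathrm{int}(\{y\in Y:r(y)=n(k)\})$, and let $s_k\in C(Y_k,M_{n(k)}(D))$ be the constant function whose value is the cyclic shift matrix, with entries $1$ in the positions $(j+1,j)$ for $1\le j<n(k)$ and in the position $(1,n(k))$, and $0$ elsewhere. There is a unique unital $*$-homomorphism $$\gamma=(\gamma_0,\dots,\gamma_l)\colon A_Y\to\bigoplus_{k=0}^l C(Y_k,M_{n(k)}(D))$$ such that for $0\le k\le l$, $0\le m<n(k)$ and $f\in C(X,D)$ vanishing on $Z_m$, the elements $fu^m$ and $u^{-m}f$ are in $A_Y$ and $$\gamma_k(fu^m)=\mathrm{diag}\bigl(f|_{Y_k},\alpha^{-1}(f)|_{Y_k},\dots,\alpha^{-[n(k)-1]}(f)|_{Y_k}\bigr)\,s_k^m,$$ $$\gamma_k(u^{-m}f)=s_k^{-m}\,\mathrm{diag}\bigl(f|_{Y_k},\alpha^{-1}(f)|_{Y_k},\dots,\alpha^{-[n(k)-1]}(f)|_{Y_k}\bigr).$$ The map $\gamma$ induces an isomorphism of $A_Y$ with the following recursive subhomogeneous algebra $R=R^{(l)}$ over $D$. Here $R^{(0)}=C(Y_0,M_{n(0)}(D))$,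 and for $1\le k\le l$, with $X_k^{(0)}=Y_k\cap\bigcup_{j=0}^{k-1}Y_j$ (a closed set), the $k$-th stage algebra is the pullback $$R^{(k)}=\bigl\{(b,f)\in R^{(k-1)}\oplus C(Y_k,M_{n(k)}(D)):\varphi_k(b)=f|_{X_k^{(0)}}\bigr\},$$ where $\varphi_k\colon R^{(k-1)}\to C(X_k^{(0)},M_{n(k)}(D))$ is the unital $*$-homomorphism determined as follows. For every $x\in X_k^{(0)}$ there are $r>0$ and $t_1,\dots,t_r\in\{0,\dots,k-1\}$ with $n(t_1)+\dots+n(t_r)=n(k)$ and $$x\in(Y_k\setminus Y_k^\circ)\cap Y_{t_1}\cap h^{-n(t_1)}(Y_{t_2})\cap\dots\cap h^{-[n(t_1)+\dots+n(t_{r-1})]}(Y_{t_r}),$$ and for all $r$, $t_1,\dots,t_r$ with these properties and all $b=(b_0,\dots,b_{k-1})\in R^{(k-1)}\subset\bigoplus_{j<k}C(Y_j,M_{n(j)}(D))$, the matrix $\varphi_k(b)(x)$ is block diagonal, $$\varphi_k(b)(x)=\mathrm{diag}\bigl(b_{t_1}(x),\ \alpha^{-n(t_1)}(b_{t_2})(x),\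 \dots,\ \alpha^{-[n(t_1)+\dots+n(t_{r-1})]}(b_{t_r})(x)\bigr),$$ where $\alpha^{-m}(c)(x)$ is obtained by applying the automorphism $\alpha_{-m,x}$ to each entry of the matrix $c(h^m(x))$. Under this isomorphism, the standard representation $R\to\bigoplus_{k=0}^lC(Y_k,M_{n(k)}(D))$, which forgets the gluing conditions, becomes $\gamma$; that is, it is the inclusion of $\gamma(A_Y)$. The topological dimension $\max_k\dim(Y_k)$ of this decomposition is $\dim(X)$, where $\dim$ is the covering dimension. -/

import Mathlib

open scoped Matrix

universe u v

noncomputable section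

namespace OrbitBreaking

/-! ### The crossed product of a unital C*-algebra by an automorphism -/

section CrossedProduct

variable {A : Type u} [CStarAlgebra A]

/-- The group `ℤ`, written multiplicatively, acting on `A` through the powers of `α`. -/
def ZAct (_α : A ≃⋆ₐ[ℂ] A) : Type := Multiplicative ℤ

variable (α : A ≃⋆ₐ[ℂ] A)

instance : CommGroup (ZAct α) := inferInstanceAs (CommGroup (Multiplicative ℤ))

/-- The integer `n` as an element of the acting group. -/
def ZAct.of (n : ℤ) : ZAct α := Multiplicative.ofAdd n

/-- The integer underlying an element of the acting group. -/
def ZAct.toInt {α : A ≃⋆ₐ[ℂ] A} (g : ZAct α) : ℤ := Multiplicative.toAdd (α := ℤ) g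

instance : MulSemiringAction (ZAct α) A where
  smul g a := (α ^ g.toInt) a
  one_smul a := by
    change (α ^ (0 : ℤ)) a = a
    rw [zpow_zero]; rfl
  mul_smul g g' a := by
    change (α ^ (g.toInt + g'.toInt)) a = (α ^ g.toInt) ((α ^ g'.toInt) a)
    rw [zpow_add]; rfl
  smul_zero g := map_zero (α ^ g.toInt)
  smul_add g := map_add (α ^ g.toInt)
  smul_one g := map_one (α ^ g.toInt)
  smul_mul g := map_mul (α ^ g.toInt)

lemma ZAct.smul_def (g : ZAct α) (a : A) : g • a = (α ^ g.toInt) a := rfl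

lemma ZAct.smul_star (g : ZAct α) (a : A) : g • star a = star (g • a) :=
  map_star (α ^ g.toInt) a

instance : SMulCommClass (ZAct α) ℂ A where
  smul_comm g c a := map_smul (α ^ g.toInt) c a

/-- The algebra `A[ℤ]` of finite sums `∑ aₙ uⁿ`, with `u a u⁻¹ = α a`. -/
abbrev SkewLaurent : Type u := SkewMonoidAlgebra A (ZAct α)

/-- `(a uⁿ)* = u⁻ⁿ a* = α⁻ⁿ(a*) u⁻ⁿ`, extended additively. -/
def SkewLaurent.starHom : SkewLaurent α →+ SkewLaurent α :=
  (Finsupp.liftAddHom (fun g : ZAct α => (SkewMonoidAlgebra.singleAddHom g⁻¹).comp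
      ((DistribSMul.toAddMonoidHom A g⁻¹).comp (starAddEquiv : A ≃+ A).toAddMonoidHom))).comp
    (AddEquiv.toAddMonoidHom SkewMonoidAlgebra.coeffAddEquiv)

instance : Star (SkewLaurent α) := ⟨SkewLaurent.starHom α⟩

lemma SkewLaurent.star_single (g : ZAct α) (a : A) :
    star (SkewMonoidAlgebra.single g a : SkewLaurent α)
      = SkewMonoidAlgebra.single g⁻¹ (g⁻¹ • star a) := by
  change SkewLaurent.starHom α _ = _
  simp [SkewLaurent.starHom]

lemma SkewLaurent.star_add' (x y : SkewLaurent α) : star (x + y) = star x + star y :=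
  map_add (SkewLaurent.starHom α) x y

lemma SkewLaurent.star_zero' : star (0 : SkewLaurent α) = 0 :=
  map_zero (SkewLaurent.starHom α)

instance : StarRing (SkewLaurent α) where
  star_involutive x := by
    induction x using SkewMonoidAlgebra.induction_on' with
    | single g a =>
      rw [SkewLaurent.star_single, SkewLaurent.star_single, ← ZAct.smul_star, star_star,
        inv_inv, smul_inv_smul]
    | add x y hx hy => rw [SkewLaurent.star_add', SkewLaurent.star_add', hx, hy]
  star_mul x y := by
    induction x using SkewMonoidAlgebra.induction_on' with
    | single g a =>
      induction y using SkewMonoidAlgebra.induction_on' with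
      | single g' b =>
        simp only [SkewMonoidAlgebra.single_mul_single, SkewLaurent.star_single, star_mul,
          mul_inv_rev, smul_mul', ← ZAct.smul_star, smul_smul]
        congr 2
        · rw [mul_assoc, inv_mul_cancel, mul_one]
      | add x y hx hy => rw [mul_add, SkewLaurent.star_add', hx, hy, SkewLaurent.star_add', add_mul]
    | add x y hx hy => rw [add_mul, SkewLaurent.star_add', hx, hy, SkewLaurent.star_add', mul_add]
  star_add := SkewLaurent.star_add' α

instance : StarModule ℂ (SkewLaurent α) where
  star_smul c x := by
    induction x using SkewMonoidAlgebra.induction_on' with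
    | single g a =>
      simp only [SkewMonoidAlgebra.smul_single, SkewLaurent.star_single, star_smul]
      rw [smul_comm]
    | add x y hx hy => rw [smul_add, star_add, hx, hy, star_add, smul_add]

/-- The C*-seminorms on `A[ℤ]` that are dominated by the `ℓ¹`-norm `∑ ‖aₙ‖`; these are the
seminorms `x ↦ ‖(π ⋊ U) x‖` coming from covariant representations `(π, U)` of `(A, ℤ, α)`. -/
structure IsCStarSeminorm (p : SkewLaurent α → ℝ) : Prop where
  add_le : ∀ x y, p (x + y) ≤ p x + p y
  smul : ∀ (c : ℂ) x, p (c • x) = ‖c‖ * p x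
  mul_le : ∀ x y, p (x * y) ≤ p x * p y
  star_mul_self : ∀ x, p (star x * x) = p x ^ 2
  le_l1 : ∀ x, p x ≤ ∑ g ∈ x.coeff.support, ‖x.coeff g‖

namespace IsCStarSeminorm

variable {α} {p : SkewLaurent α → ℝ}
lemma map_zero (hp : IsCStarSeminorm α p) : p 0 = 0 := by
  have := hp.smul 0 0
  simpa using this

lemma map_neg (hp : IsCStarSeminorm α p) (x : SkewLaurent α) : p (-x) = p x := by
  have := hp.smul (-1) x
  simpa using this

lemma nonneg (hp : IsCStarSeminorm α p) (x : SkewLaurent α) : 0 ≤ p x := by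
  have h1 := hp.add_le x (-x)
  rw [add_neg_cancel, hp.map_zero, hp.map_neg] at h1
  linarith

lemma zero : IsCStarSeminorm α (fun _ => 0) where
  add_le _ _ := by simp
  smul _ _ := by simp
  mul_le _ _ := by simp
  star_mul_self _ := by simp
  le_l1 _ := Finset.sum_nonneg fun _ _ => norm_nonneg _

end IsCStarSeminorm

/-- The norm of the full crossed product: the supremum of all C*-seminorms on `A[ℤ]`. -/
def maxNorm (x : SkewLaurent α) : ℝ :=
  ⨆ p : {p : SkewLaurent α → ℝ // IsCStarSeminorm α p}, p.1 x

instance : Nonempty {p : SkewLaurent α → ℝ // IsCStarSeminorm α p} :=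
  ⟨⟨_, IsCStarSeminorm.zero⟩⟩

lemma maxNorm_bdd (x : SkewLaurent α) :
    BddAbove (Set.range fun p : {p : SkewLaurent α → ℝ // IsCStarSeminorm α p} => p.1 x) :=
  ⟨_, by rintro _ ⟨p, rfl⟩; exact p.2.le_l1 x⟩

lemma le_maxNorm {p : SkewLaurent α → ℝ} (hp : IsCStarSeminorm α p) (x : SkewLaurent α) :
    p x ≤ maxNorm α x :=
  le_ciSup (maxNorm_bdd α x) ⟨p, hp⟩

lemma maxNorm_nonneg (x : SkewLaurent α) : 0 ≤ maxNorm α x :=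
  le_maxNorm α IsCStarSeminorm.zero x

lemma isCStarSeminorm_maxNorm : IsCStarSeminorm α (maxNorm α) where
  add_le x y := ciSup_le fun p => (p.2.add_le x y).trans
    (add_le_add (le_maxNorm α p.2 x) (le_maxNorm α p.2 y))
  smul c x := by
    simp only [maxNorm]
    rw [Real.mul_iSup_of_nonneg (norm_nonneg c)]
    exact iSup_congr fun p => p.2.smul c x
  mul_le x y := ciSup_le fun p => (p.2.mul_le x y).trans
    (mul_le_mul (le_maxNorm α p.2 x) (le_maxNorm α p.2 y) (p.2.nonneg y) (maxNorm_nonneg α x))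
  star_mul_self x := by
    apply le_antisymm
    · refine ciSup_le fun p => ?_
      rw [p.2.star_mul_self]
      exact pow_le_pow_left₀ (p.2.nonneg x) (le_maxNorm α p.2 x) 2
    · have h : maxNorm α x ≤ √(maxNorm α (star x * x)) := ciSup_le fun p => by
        apply Real.le_sqrt_of_sq_le
        rw [← p.2.star_mul_self]
        exact le_maxNorm α p.2 _
      exact (Real.le_sqrt (maxNorm_nonneg α _) (maxNorm_nonneg α _)).1 h
  le_l1 x := ciSup_le fun p => p.2.le_l1 x

instance : SeminormedRing (SkewLaurent α) where
  toRing := inferInstance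
  toPseudoMetricSpace := (AddGroupSeminorm.toSeminormedAddCommGroup
    { toFun := maxNorm α
      map_zero' := (isCStarSeminorm_maxNorm α).map_zero
      add_le' := (isCStarSeminorm_maxNorm α).add_le
      neg' := (isCStarSeminorm_maxNorm α).map_neg }).toPseudoMetricSpace
  norm := maxNorm α
  dist_eq _ _ := rfl
  norm_mul_le := (isCStarSeminorm_maxNorm α).mul_le

lemma SkewLaurent.norm_def (x : SkewLaurent α) : ‖x‖ = maxNorm α x := rfl

instance : NormedSpace ℂ (SkewLaurent α) where
  norm_smul_le c x := ((isCStarSeminorm_maxNorm α).smul c x).le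

lemma SkewLaurent.norm_star_mul_self (x : SkewLaurent α) : ‖star x * x‖ = ‖x‖ * ‖x‖ :=
  ((isCStarSeminorm_maxNorm α).star_mul_self x).trans (sq _)

lemma SkewLaurent.norm_le_norm_star (x : SkewLaurent α) : ‖x‖ ≤ ‖star x‖ := by
  rcases (norm_nonneg x).eq_or_lt with h | h
  · rw [← h]; exact norm_nonneg _
  · have := norm_mul_le (star x) x
    rw [SkewLaurent.norm_star_mul_self] at this
    exact le_of_mul_le_mul_right this h

lemma SkewLaurent.norm_star (x : SkewLaurent α) : ‖star x‖ = ‖x‖ :=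
  le_antisymm (by simpa using SkewLaurent.norm_le_norm_star α (star x))
    (SkewLaurent.norm_le_norm_star α x)

/-- The full crossed product `C*(ℤ, A, α)`: the (Hausdorff) completion of `A[ℤ]` in the largest
C*-seminorm. -/
abbrev CrossedProduct : Type u := UniformSpace.Completion (SkewLaurent α)

lemma SkewLaurent.uniformContinuous_star :
    UniformContinuous (star : SkewLaurent α → SkewLaurent α) :=
  (AddMonoidHomClass.isometry_of_norm (SkewLaurent.starHom α)
    (SkewLaurent.norm_star α)).uniformContinuous

namespace CrossedProduct

open UniformSpace

instance : Star (CrossedProduct α) := ⟨Completion.map star⟩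

lemma coe_star (x : SkewLaurent α) :
    star (x : CrossedProduct α) = ((star x : SkewLaurent α) : CrossedProduct α) :=
  Completion.map_coe (SkewLaurent.uniformContinuous_star α) x

lemma continuous_star' : Continuous (star : CrossedProduct α → CrossedProduct α) :=
  Completion.continuous_map

instance : StarRing (CrossedProduct α) where
  star_involutive x := by
    induction x using Completion.induction_on with
    | hp => exact isClosed_eq ((continuous_star' α).comp (continuous_star' α)) continuous_id
    | ih x => rw [coe_star, coe_star, star_star]
  star_mul x y := by
    induction x, y using Completion.induction_on₂ with
    | hp =>
      exact isClosed_eq ((continuous_star' α).comp continuous_mul)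
        (((continuous_star' α).comp continuous_snd).mul
          ((continuous_star' α).comp continuous_fst))
    | ih x y => rw [← Completion.coe_mul, coe_star, coe_star, coe_star, star_mul, Completion.coe_mul]
  star_add x y := by
    induction x, y using Completion.induction_on₂ with
    | hp =>
      exact isClosed_eq ((continuous_star' α).comp continuous_add)
        (((continuous_star' α).comp continuous_fst).add
          ((continuous_star' α).comp continuous_snd))
    | ih x y => rw [← Completion.coe_add, coe_star, coe_star, coe_star, star_add, Completion.coe_add]

instance : CStarRing (CrossedProduct α) where
  norm_mul_self_le x := by
    induction x using Completion.induction_on with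
    | hp =>
      exact isClosed_le (continuous_norm.mul continuous_norm)
        (continuous_norm.comp ((continuous_star' α).mul continuous_id))
    | ih x =>
      rw [coe_star, ← Completion.coe_mul, Completion.norm_coe, Completion.norm_coe,
        SkewLaurent.norm_star_mul_self]

instance : NormedAlgebra ℂ (CrossedProduct α) where
  toAlgebra := inferInstance
  norm_smul_le := norm_smul_le

instance : StarModule ℂ (CrossedProduct α) where
  star_smul c x := by
    induction x using Completion.induction_on with
    | hp =>
      exact isClosed_eq ((continuous_star' α).comp (continuous_const_smul c))
        ((continuous_star' α).const_smul (star c))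
    | ih x => rw [← Completion.coe_smul, coe_star, coe_star, star_smul, Completion.coe_smul]

instance : CStarAlgebra (CrossedProduct α) where

/-- The canonical copy of `A` in the crossed product. -/
def incl (a : A) : CrossedProduct α := ((SkewMonoidAlgebra.single 1 a : SkewLaurent α) :)

/-- The canonical unitary `u` of the crossed product, with `u a u* = α a`. -/
def u : CrossedProduct α := ((SkewMonoidAlgebra.single (ZAct.of α 1) 1 : SkewLaurent α) :)

end CrossedProduct

end CrossedProduct

/-! ### Minimal homeomorphisms, actions lying over them, and first return times -/

section Dynamics

variable {X : Type u} [TopologicalSpace X]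

/-- A homeomorphism is minimal if all of its orbits are dense. -/
def IsMinimalHomeo (h : X ≃ₜ X) : Prop :=
  ∀ x, Dense (Set.range fun n : ℤ => (h ^ n) x)

/-- The first return time `r(y) = inf {m ≥ 1 : hᵐ(y) ∈ Y}`. -/
def returnTime (h : X ≃ₜ X) (Y : Set X) (y : X) : ℕ :=
  sInf {m : ℕ | 1 ≤ m ∧ (h ^ m) y ∈ Y}

/-- The closure of the set of points of `Y` with first return time `N`. -/
def towerBase (h : X ≃ₜ X) (Y : Set X) (N : ℕ) : Set X :=
  closure {y | y ∈ Y ∧ returnTime h Y y = N}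

/-- The interior of the set of points of `Y` with first return time `N`. -/
def towerCore (h : X ≃ₜ X) (Y : Set X) (N : ℕ) : Set X :=
  interior {y | y ∈ Y ∧ returnTime h Y y = N}

/-- `Z_m = Y ∪ h(Y) ∪ ⋯ ∪ h^{m-1}(Y)`. -/
def levelUnion (h : X ≃ₜ X) (Y : Set X) (m : ℕ) : Set X :=
  ⋃ j : Fin m, (h ^ (j : ℕ)) '' Y

/-- Some open refinement of every finite open cover of `X` has order at most `n`, that is, any
`n + 2` of its members have empty intersection. -/
def CoveringDimLE (X : Type u) [TopologicalSpace X] (n : ℕ) : Prop :=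
  ∀ U : Set (Set X), U.Finite → (∀ s ∈ U, IsOpen s) → ⋃₀ U = Set.univ →
    ∃ V : Set (Set X), (∀ s ∈ V, IsOpen s) ∧ ⋃₀ V = Set.univ ∧ (∀ s ∈ V, ∃ t ∈ U, s ⊆ t) ∧
      ∀ F : Finset (Set X), (F : Set (Set X)) ⊆ V → F.card = n + 2 → ⋂₀ (F : Set (Set X)) = ∅

/-- The covering dimension of `X`; it is `⊥` for the empty space, and `⊤` if no finite bound
exists. -/
def coveringDim (X : Type u) [TopologicalSpace X] : WithBot ℕ∞ :=
  sInf {d | IsEmpty X ∨ ∃ n : ℕ, d = ((n : ℕ∞) : WithBot ℕ∞) ∧ CoveringDimLE X n}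

variable [CompactSpace X] {D : Type v} [CStarAlgebra D]

/-- The automorphism `α` of `C(X, D)` lies over `h`: every power `αⁿ` has the form
`αⁿ(a)(x) = β_{n,x}(a(h⁻ⁿ x))` with automorphisms `β_{n,x}` of `D`. -/
def LiesOver (α : C(X, D) ≃⋆ₐ[ℂ] C(X, D)) (h : X ≃ₜ X) : Prop :=
  ∃ β : ℤ → X → (D ≃⋆ₐ[ℂ] D), ∀ (n : ℤ) (x : X) (a : C(X, D)),
    (α ^ n) a x = β n x (a ((h ^ (-n)) x))

open CrossedProduct in
/-- The orbit breaking subalgebra `C*(ℤ, C(X, D), α)_Y`: the C*-subalgebra of the crossed product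
generated by `C(X, D)` and `C₀(X ∖ Y, D) u`. -/
def orbitBreaking (α : C(X, D) ≃⋆ₐ[ℂ] C(X, D)) (Y : Set X) : StarSubalgebra ℂ (CrossedProduct α) :=
  (StarAlgebra.adjoin ℂ
    (Set.range (incl α) ∪ {a | ∃ f : C(X, D), (∀ x ∈ Y, f x = 0) ∧ a = incl α f * u α})
    ).topologicalClosure

/-- `α⁻ᵐ` on the fibre at `x`: if `α` lies over `h`, then `α⁻ᵐ(f)(x) = fiberPull α m x (f (hᵐ x))`
for all `f`. -/
def fiberPull (α : C(X, D) ≃⋆ₐ[ℂ] C(X, D)) (m : ℕ) (x : X) (d : D) : D :=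
  (α ^ (-(m : ℤ))) (ContinuousMap.const X d) x

end Dynamics

/-! ### The tower map -/

section TowerMap

/-- `C(B, M_N(D))`, as a *-algebra. The topology of `M_N(D)` is that of entrywise convergence, which
is the topology of its unique C*-norm. -/
abbrev MatFun (B : Type u) [TopologicalSpace B] (N : ℕ) (D : Type v) [CStarAlgebra D] :
    Type (max u v) :=
  C(B, Matrix (Fin N) (Fin N) D)

variable {X : Type u} [TopologicalSpace X] [CompactSpace X] {D : Type v} [CStarAlgebra D]

/-- `diag(f|_B, α⁻¹(f)|_B, …, α^{-(N-1)}(f)|_B)`. -/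
def towerDiag (α : C(X, D) ≃⋆ₐ[ℂ] C(X, D)) (B : Set X) (N : ℕ) (f : C(X, D)) : MatFun B N D where
  toFun y := Matrix.diagonal fun i : Fin N => (α ^ (-((i : ℕ) : ℤ))) f y
  continuous_toFun := by fun_prop

/-- The constant function whose value is the cyclic shift matrix, with entries `1` in positions
`(j + 1, j)` and `(0, N - 1)`. -/
def shift (B : Set X) (N : ℕ) (D : Type v) [CStarAlgebra D] : MatFun B N D :=
  ContinuousMap.const B (Matrix.of fun i j : Fin N => if (i : ℕ) = (j + 1) % N then 1 else 0)

open CrossedProduct in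
/-- The *-homomorphism `γ = (γ_0, …, γ_l)` satisfies, for `0 ≤ m < n(k)` and `f` vanishing on
`Z_m`, the equations `γ_k(f uᵐ) = diag(f, α⁻¹ f, …) sᵐ` and `γ_k(u⁻ᵐ f) = s⁻ᵐ diag(f, α⁻¹ f, …)`
(`u` and `s` are unitary). -/
structure IsTowerMap (h : X ≃ₜ X) (α : C(X, D) ≃⋆ₐ[ℂ] C(X, D)) (Y : Set X) {l : ℕ}
    (n : Fin (l + 1) → ℕ)
    (γ : orbitBreaking α Y →⋆ₐ[ℂ] ∀ k, MatFun (towerBase h Y (n k)) (n k) D) : Prop where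
  pos : ∀ (k : Fin (l + 1)) (m : ℕ), m < n k → ∀ f : C(X, D), (∀ x ∈ levelUnion h Y m, f x = 0) →
    ∃ ha : incl α f * u α ^ m ∈ orbitBreaking α Y,
      γ ⟨_, ha⟩ k = towerDiag α _ (n k) f * shift _ (n k) D ^ m
  neg : ∀ (k : Fin (l + 1)) (m : ℕ), m < n k → ∀ f : C(X, D), (∀ x ∈ levelUnion h Y m, f x = 0) →
    ∃ ha : star (u α) ^ m * incl α f ∈ orbitBreaking α Y,
      γ ⟨_, ha⟩ k = star (shift _ (n k) D) ^ m * towerDiag α _ (n k) f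

/-- The block diagonal matrix with diagonal blocks `M 0, M 1, …` (in this order). -/
def blockDiag {D : Type v} [Zero D] {r N : ℕ} (m : Fin r → ℕ) (hN : ∑ i, m i = N)
    (M : ∀ i, Matrix (Fin (m i)) (Fin (m i)) D) : Matrix (Fin N) (Fin N) D :=
  Matrix.reindex (finSigmaFinEquiv.trans (finCongr hN)) (finSigmaFinEquiv.trans (finCongr hN))
    (Matrix.blockDiagonal' M)

end TowerMap

/-! ### Recursive subhomogeneous algebras over `D` -/

section RSHA

/-- Restriction of families indexed by `j ≤ k + 1` to `j ≤ k`. -/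
def truncate {l : ℕ} {E : Fin (l + 1) → Type u} (k : Fin l) (b : ∀ j : Set.Iic k.succ, E j) :
    ∀ j : Set.Iic k.castSucc, E j :=
  fun j => b ⟨j, le_trans j.2 k.castSucc_le_succ⟩

/-- A decomposition of length `l` of a recursive subhomogeneous algebra over `D`,
`[⋯[C(B₀, M_{n(0)}(D)) ⊕_{C(B₁⁰, M_{n(1)}(D))} C(B₁, M_{n(1)}(D))] ⊕ ⋯] ⊕ C(B_l, M_{n(l)}(D))`,
with base spaces `B k`, matrix sizes `n k`, and closed subspaces `B0 k` of `B (k + 1)`. The `k`-th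
stage algebra is realized, through its standard representation, as a subalgebra of
`⨁_{j ≤ k} C(B j, M_{n(j)}(D))`; stage `k + 1` is the pullback of stage `k` and
`C(B (k + 1), M_{n(k+1)}(D))` along the unital homomorphism `φ k` and the restriction map. -/
structure RSHADecomposition (D : Type v) [CStarAlgebra D] {l : ℕ} (B : Fin (l + 1) → Type u)
    [∀ k, TopologicalSpace (B k)] (n : Fin (l + 1) → ℕ) (B0 : ∀ k : Fin l, Set (B k.succ)) where
  compactSpace : ∀ k, CompactSpace (B k)
  t2Space : ∀ k, T2Space (B k)
  size_pos : ∀ k, 1 ≤ n k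
  isClosed : ∀ k, IsClosed (B0 k)
  stage : ∀ k : Fin (l + 1), StarSubalgebra ℂ (∀ j : Set.Iic k, MatFun (B j) (n j) D)
  φ : ∀ k : Fin l, stage k.castSucc →⋆ₐ[ℂ] MatFun (B0 k) (n k.succ) D
  stage_zero : stage 0 = ⊤
  mem_stage_succ : ∀ (k : Fin l) (b : ∀ j : Set.Iic k.succ, MatFun (B j) (n j) D),
    b ∈ stage k.succ ↔ ∃ hb : truncate (E := fun j => MatFun (B j) (n j) D) k b ∈ stage k.castSucc,
      φ k ⟨_, hb⟩ = (b ⟨k.succ, Set.mem_Iic.2 le_rfl⟩).restrict (B0 k)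

namespace RSHADecomposition

variable {D : Type v} [CStarAlgebra D] {l : ℕ} {B : Fin (l + 1) → Type u}
  [∀ k, TopologicalSpace (B k)] {n : Fin (l + 1) → ℕ} {B0 : ∀ k : Fin l, Set (B k.succ)}

/-- The recursive subhomogeneous algebra with the given decomposition. -/
abbrev Algebra (R : RSHADecomposition D B n B0) : Type (max u v) := R.stage (Fin.last l)

/-- The standard representation `R → ⨁_k C(B k, M_{n(k)}(D))`. -/
def standardRep (R : RSHADecomposition D B n B0) : R.Algebra → ∀ k, MatFun (B k) (n k) D :=
  fun b k => b.1 ⟨k, Set.mem_Iic.2 (Fin.le_last k)⟩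

/-- The topological dimension of the decomposition. -/
def topologicalDim (_R : RSHADecomposition D B n B0) : WithBot ℕ∞ :=
  ⨆ k, coveringDim (B k)

end RSHADecomposition

end RSHA

section Gluing

variable {X : Type u} [TopologicalSpace X]

/-- `s_i = n(t_0) + ⋯ + n(t_{i-1})`. -/
def partialSum {r : ℕ} (m : Fin r → ℕ) (i : Fin r) : ℕ := ∑ j ∈ Finset.Iio i, m j

/-- The tuple `t = (t_0, …, t_{r-1})` of indices in `{0, …, k}` is a return itinerary for `x` with
total time `n(k+1)`: one has `∑ n(t_i) = n(k+1)`, and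
`x ∈ (Y_{k+1} ∖ Y_{k+1}°) ∩ Y_{t_0} ∩ h^{-n(t_0)}(Y_{t_1}) ∩ h^{-(n(t_0)+n(t_1))}(Y_{t_2}) ∩ ⋯`. -/
structure IsItinerary (h : X ≃ₜ X) (Y : Set X) {l : ℕ} (n : Fin (l + 1) → ℕ) (k : Fin l) (x : X)
    {r : ℕ} (t : Fin r → Set.Iic k.castSucc) : Prop where
  pos : 0 < r
  sum_eq : ∑ i, n (t i) = n k.succ
  mem_diff : x ∈ towerBase h Y (n k.succ) \ towerCore h Y (n k.succ)
  mem_base : ∀ i, (h ^ partialSum (fun i => n (t i)) i) x ∈ towerBase h Y (n (t i))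

end Gluing

end OrbitBreaking

end

open OrbitBreaking

noncomputable section

namespace OrbitBreaking

/-! ### The regular representation -/

section RegularRepresentation

variable {A : Type u} [CStarAlgebra A] (α : A ≃⋆ₐ[ℂ] A)

/-! The proof replaces the C*-algebra `A_Y` by an algebra of finite Fourier sums and then works
orbit by orbit. Write `A = C(X, D)`. Right multiplication on the pre-Hilbert module `A[ℤ]` gives a
C*-seminorm that dominates every Fourier coefficient (`SkewLaurent.norm_coeff_le`), so the
coefficients extend continuously to the crossed product. By minimality and compactness, all orbits
visit `Y` with gaps bounded by some `M`. Two positions on an orbit are separated if a visit to `Y`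
happens after the smaller one and not after the larger one. The sums `∑ fₘ uᵐ` with `fₘ(z) = 0`
whenever `0` and `-m` are separated along the orbit of `z` form a *-algebra, because non-separation
is an equivalence relation. Only degrees `|m| ≤ M` occur, so this algebra is closed in the crossed
product, and it equals `A_Y` (`orbitBreaking_eq_map`).

The visits cut each orbit into blocks, and an element of `A_Y` is a block diagonal matrix along the
orbit, with entries `α⁻ⁱ(f_{i-j})(y)`. For `y ∈ Y_k` the positions `0 ≤ i, j < n(k)` give `γ_k(y)`.
Both `y` and `h^{n(k)}(y)` lie in `Y`, so no nonzero entry leaves this segment and `γ_k` is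
multiplicative (`sum_entries_mul`). Uniqueness holds because `A_Y` is the algebraic span of the
monomials in it, and the C*-identity forces `γ_k(f uᵐ) = 0` for `m ≥ n(k)`.

Conversely, a family `b` of matrix functions has a `symbol`: the would-be coefficients at `z`, read
off from `b` over the last visit of the orbit to `Y`. The symbol determines a matrix over every
orbit segment, and `b` comes from `A_Y` exactly if each `b_j(y)` is the matrix of the symbol of `b`.
Where the return time of `y` is `n(j)` this is automatic. Elsewhere on `Y_j` the return time is
smaller, and the condition writes `b_j(y)` as a block diagonal matrix of earlier members, which is
the gluing condition. Compatible families have continuous symbols, since the sets `h^p(Y_j)` form a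
finite closed cover of `X` (`continuousOn_symbol`); hence they all come from `A_Y`. The same cover
and the finite closed sum theorem give the dimension. -/

lemma SkewLaurent.induction_single {P : SkewLaurent α → Prop} (x : SkewLaurent α)
    (single : ∀ g a, P (SkewMonoidAlgebra.single g a)) (add : ∀ x y, P x → P y → P (x + y)) :
    P x :=
  SkewMonoidAlgebra.induction_on' x single fun {x y} hx hy => add x y hx hy

/-- `A[ℤ]`, regarded as a left pre-Hilbert module over `A`. -/
def RegularModule : Type u := SkewLaurent α

instance : AddCommGroup (RegularModule α) := inferInstanceAs (AddCommGroup (SkewLaurent α))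
instance : Module ℂ (RegularModule α) := inferInstanceAs (Module ℂ (SkewLaurent α))

namespace RegularModule

/-- The element of `A[ℤ]` underlying a vector. -/
def toSkew : RegularModule α →ₗ[ℂ] SkewLaurent α := LinearMap.id

/-- Right multiplication by an element of `A[ℤ]`. -/
def rmul (x : SkewLaurent α) : RegularModule α →ₗ[ℂ] RegularModule α where
  toFun ξ := (toSkew α ξ * x : SkewLaurent α)
  map_add' ξ η := add_mul (toSkew α ξ) (toSkew α η) x
  map_smul' c ξ := smul_mul_assoc c (toSkew α ξ) x

lemma toSkew_rmul (x : SkewLaurent α) (ξ : RegularModule α) :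
    toSkew α (rmul α x ξ) = toSkew α ξ * x := rfl

instance : SMul A (RegularModule α) where
  smul a ξ := (SkewMonoidAlgebra.single 1 a * toSkew α ξ : SkewLaurent α)

instance : Inner A (RegularModule α) where
  inner ξ η := (toSkew α η * star (toSkew α ξ)).coeff 1

instance : Norm (RegularModule α) := CStarModule.norm A

lemma toSkew_smul (a : A) (ξ : RegularModule α) :
    toSkew α (a • ξ) = SkewMonoidAlgebra.single 1 a * toSkew α ξ := rfl

lemma inner_def (ξ η : RegularModule α) :
    inner A ξ η = (toSkew α η * star (toSkew α ξ)).coeff 1 := rfl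

lemma coeff_star (x : SkewLaurent α) (g : ZAct α) :
    (star x).coeff g = g • star (x.coeff g⁻¹) := by
  induction x using SkewLaurent.induction_single with
  | single k a =>
    classical
    rw [SkewLaurent.star_single]
    simp only [SkewMonoidAlgebra.coeff_single, Finsupp.single_apply]
    by_cases hk : k⁻¹ = g
    · subst hk; simp
    · rw [if_neg hk, if_neg (fun h => hk (by rw [h, inv_inv]))]; simp
  | add x y hx hy => rw [star_add]; simp [hx, hy]

/-- A product of two terms contributes to the coefficient at `1` only if their degrees cancel. So
the inner product is the one of `ℓ²(ℤ, A)`, and its positivity is visible. -/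
lemma inner_eq_sum (x y : SkewLaurent α) :
    (x * star y).coeff 1 = x.coeff.sum fun g a => a * star (y.coeff g) := by
  induction x using SkewLaurent.induction_single with
  | single k a =>
    rw [SkewMonoidAlgebra.coeff_single, Finsupp.sum_single_index (by simp)]
    induction y using SkewLaurent.induction_single with
    | single k' b =>
      classical
      rw [SkewLaurent.star_single, SkewMonoidAlgebra.single_mul_single]
      simp only [SkewMonoidAlgebra.coeff_single, Finsupp.single_apply]
      by_cases hk : k = k'
      · subst hk; simp
      · rw [if_neg (fun h => hk (mul_inv_eq_one.1 h)), if_neg (Ne.symm hk)]; simp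
    | add x y hx hy => simp [star_add, mul_add, hx, hy]
  | add x y hx hy =>
    rw [add_mul, SkewMonoidAlgebra.coeff_add, Finsupp.add_apply, hx, hy,
      SkewMonoidAlgebra.coeff_add, Finsupp.sum_add_index' (by simp) (by simp [add_mul])]

lemma inner_rmul_left (x : SkewLaurent α) (ξ η : RegularModule α) :
    inner A (rmul α x ξ) η = inner A ξ (rmul α (star x) η) := by
  simp only [inner_def, toSkew_rmul, star_mul, mul_assoc]

variable [PartialOrder A] [StarOrderedRing A]

/-- One term of a sum of positive elements. It yields both definiteness of the inner product and,
later, the bound on Fourier coefficients. -/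
lemma le_inner_self (ξ : RegularModule α) (g : ZAct α) :
    (toSkew α ξ).coeff g * star ((toSkew α ξ).coeff g) ≤ inner A ξ ξ := by
  rw [inner_def, inner_eq_sum, Finsupp.sum]
  by_cases hg : g ∈ (toSkew α ξ).coeff.support
  · exact Finset.single_le_sum (f := fun g => (toSkew α ξ).coeff g * star ((toSkew α ξ).coeff g))
      (fun i _ => mul_star_self_nonneg _) hg
  · rw [Finsupp.notMem_support_iff.1 hg, zero_mul]
    exact Finset.sum_nonneg fun i _ => mul_star_self_nonneg _

lemma inner_self_nonneg' (ξ : RegularModule α) : 0 ≤ inner A ξ ξ :=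
  (mul_star_self_nonneg _).trans (le_inner_self α ξ 1)

instance : CStarModule A (RegularModule α) where
  inner_add_right {x y z} := by simp [inner_def, map_add, add_mul]
  inner_self_nonneg := inner_self_nonneg' α _
  inner_self {x} := by
    constructor
    · intro hx
      refine SkewMonoidAlgebra.ext fun g => ?_
      have := le_inner_self α x g
      rw [hx] at this
      exact CStarRing.mul_star_self_eq_zero_iff _ |>.1 (this.antisymm (mul_star_self_nonneg _))
    · rintro rfl
      simp [inner_def]
  inner_op_smul_right {a x y} := by
    rw [inner_def, toSkew_smul, mul_assoc, inner_def]
    generalize toSkew α y * star (toSkew α x) = z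
    induction z using SkewLaurent.induction_single with
    | single k b =>
      classical
      rw [SkewMonoidAlgebra.single_mul_single]
      by_cases hk : k = 1 <;> simp [SkewMonoidAlgebra.coeff_single, hk]
    | add x y hx hy => simp [mul_add, hx, hy]
  inner_smul_right_complex {z x y} := by
    simp [inner_def, map_smul, SkewMonoidAlgebra.coeff_smul]
  star_inner x y := by
    have := coeff_star α (toSkew α y * star (toSkew α x)) 1
    rw [inv_one, one_smul] at this
    rw [inner_def, ← this, inner_def, star_mul, star_star]
  norm_eq_sqrt_norm_inner_self _ := rfl

instance : NormedAddCommGroup (RegularModule α) := CStarModule.normedAddCommGroup A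
instance : NormedSpace ℂ (RegularModule α) := .ofCore (CStarModule.normedSpaceCore A)

/-- The inner square of `ξ · (a g)` is `∑ ξₖ (k • a a*) ξₖ*`, and `k • a a* ≤ ‖a‖²` for each `k`. -/
lemma norm_rmul_single_le (g : ZAct α) (a : A) (ξ : RegularModule α) :
    ‖rmul α (SkewMonoidAlgebra.single g a) ξ‖ ≤ ‖a‖ * ‖ξ‖ := by
  have key : inner A (rmul α (SkewMonoidAlgebra.single g a) ξ)
      (rmul α (SkewMonoidAlgebra.single g a) ξ) ≤ (‖a‖ ^ 2) • inner A ξ ξ := by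
    have h1 : ∀ x : SkewLaurent α, (x * (SkewMonoidAlgebra.single 1 (a * star a)) * star x).coeff 1 =
        x.coeff.sum fun g b => b * (g • (a * star a)) * star b := by
      intro x
      rw [inner_eq_sum]
      have h2 : ∀ k, (x * (SkewMonoidAlgebra.single 1 (a * star a))).coeff k
          = x.coeff k * (k • (a * star a)) := by
        intro k
        induction x using SkewLaurent.induction_single with
        | single k' b =>
          classical
          rw [SkewMonoidAlgebra.single_mul_single, mul_one]
          simp only [SkewMonoidAlgebra.coeff_single, Finsupp.single_apply]
          split_ifs with h
          · rw [h]
          · simp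
        | add x y hx hy => simp [add_mul, hx, hy]
      rw [Finsupp.sum_of_support_subset (s := x.coeff.support)]
      · exact Finset.sum_congr rfl fun k _ => by simp only [h2]
      · intro k hk
        rw [Finsupp.mem_support_iff] at hk ⊢
        intro h
        exact hk (by rw [h2, h, zero_mul])
      · simp
    have h3 : inner A (rmul α (SkewMonoidAlgebra.single g a) ξ)
      (rmul α (SkewMonoidAlgebra.single g a) ξ) =
        (toSkew α ξ * (SkewMonoidAlgebra.single 1 (a * star a)) * star (toSkew α ξ)).coeff 1 := by
      rw [inner_def, toSkew_rmul, star_mul, SkewLaurent.star_single, mul_assoc, mul_assoc,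
        ← mul_assoc (SkewMonoidAlgebra.single g a), SkewMonoidAlgebra.single_mul_single,
        mul_inv_cancel, smul_inv_smul]
    rw [h3, h1, inner_def, inner_eq_sum, Finsupp.sum, Finsupp.sum, Finset.smul_sum]
    refine Finset.sum_le_sum fun k _ => ?_
    refine (CStarAlgebra.star_right_conjugate_le_norm_smul (hb := ?_)).trans_eq ?_
    · rw [smul_mul', ZAct.smul_star]
      exact IsSelfAdjoint.mul_star_self _
    · rw [ZAct.smul_def, StarAlgEquiv.norm_map, CStarRing.norm_self_mul_star, sq]
  have := CStarAlgebra.norm_le_norm_of_nonneg_of_le (inner_self_nonneg' α _) key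
  rw [norm_smul, ← CStarModule.norm_sq_eq, ← CStarModule.norm_sq_eq, norm_pow, norm_norm,
    ← mul_pow] at this
  exact le_of_sq_le_sq this (by positivity)

lemma norm_rmul_le (x : SkewLaurent α) (ξ : RegularModule α) :
    ‖rmul α x ξ‖ ≤ (∑ g ∈ x.coeff.support, ‖x.coeff g‖) * ‖ξ‖ := by
  have h : rmul α x ξ = ∑ g ∈ x.coeff.support,
      rmul α (SkewMonoidAlgebra.single g (x.coeff g)) ξ := by
    conv_lhs => rw [← SkewMonoidAlgebra.sum_single x]
    exact Finset.mul_sum _ _ (toSkew α ξ)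
  rw [h, Finset.sum_mul]
  exact (norm_sum_le _ _).trans (Finset.sum_le_sum fun g _ => norm_rmul_single_le α g _ ξ)

/-! ### The C*-seminorm of the regular representation -/

/-- Right multiplication by an element of `A[ℤ]`, as a bounded operator. -/
def rmulL (x : SkewLaurent α) : RegularModule α →L[ℂ] RegularModule α :=
  (rmul α x).mkContinuous _ (norm_rmul_le α x)

lemma rmulL_apply (x : SkewLaurent α) (ξ : RegularModule α) : rmulL α x ξ = rmul α x ξ := rfl

/-- Cauchy–Schwarz applied to `⟨ξ x, ξ x⟩ = ⟨ξ, ξ x x*⟩`. The product is `x x*` and not `x* x`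
because right multiplications compose in the opposite order. -/
lemma norm_rmulL_sq_le (x : SkewLaurent α) : ‖rmulL α x‖ ^ 2 ≤ ‖rmulL α (x * star x)‖ := by
  have h : ‖rmulL α x‖ ≤ √‖rmulL α (x * star x)‖ := by
    refine ContinuousLinearMap.opNorm_le_bound _ (Real.sqrt_nonneg _) fun ξ => ?_
    refine le_of_sq_le_sq ?_ (by positivity)
    rw [mul_pow, Real.sq_sqrt (norm_nonneg _), CStarModule.norm_sq_eq A, rmulL_apply,
      inner_rmul_left]
    have h2 : rmul α (star x) (rmul α x ξ) = rmulL α (x * star x) ξ := mul_assoc (toSkew α ξ) _ _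
    rw [h2]
    refine (CStarModule.norm_inner_le (RegularModule α)).trans ?_
    calc ‖ξ‖ * ‖rmulL α (x * star x) ξ‖ ≤ ‖ξ‖ * (‖rmulL α (x * star x)‖ * ‖ξ‖) := by
          gcongr; exact ContinuousLinearMap.le_opNorm _ _
      _ = _ := by ring
  exact (Real.le_sqrt (norm_nonneg _) (norm_nonneg _)).1 h

lemma norm_rmulL_mul_le (x y : SkewLaurent α) : ‖rmulL α (x * y)‖ ≤ ‖rmulL α x‖ * ‖rmulL α y‖ := by
  have : rmulL α (x * y) = (rmulL α y).comp (rmulL α x) := by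
    ext ξ; exact (mul_assoc (toSkew α ξ) x y).symm
  rw [this, mul_comm]
  exact ContinuousLinearMap.opNorm_comp_le _ _

lemma norm_rmulL_le_star (x : SkewLaurent α) : ‖rmulL α x‖ ≤ ‖rmulL α (star x)‖ := by
  rcases (norm_nonneg (rmulL α x)).eq_or_lt with h | h
  · rw [← h]; exact norm_nonneg _
  · have := (norm_rmulL_sq_le α x).trans (norm_rmulL_mul_le α x (star x))
    rw [sq] at this
    exact le_of_mul_le_mul_left this h

lemma norm_rmulL_star (x : SkewLaurent α) : ‖rmulL α (star x)‖ = ‖rmulL α x‖ :=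
  le_antisymm (by simpa using norm_rmulL_le_star α (star x)) (norm_rmulL_le_star α x)

lemma isCStarSeminorm_rmulL : IsCStarSeminorm α fun x => ‖rmulL α x‖ where
  add_le x y := by
    have : rmulL α (x + y) = rmulL α x + rmulL α y := by
      ext ξ; exact mul_add (toSkew α ξ) x y
    rw [this]; exact norm_add_le _ _
  smul c x := by
    have : rmulL α (c • x) = c • rmulL α x := by
      ext ξ; exact mul_smul_comm c (toSkew α ξ) x
    rw [this]; exact norm_smul _ _
  mul_le := norm_rmulL_mul_le α
  star_mul_self x := by
    refine le_antisymm ((norm_rmulL_mul_le α _ _).trans_eq ?_) ?_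
    · rw [norm_rmulL_star, sq]
    · have := norm_rmulL_sq_le α (star x)
      rwa [star_star, norm_rmulL_star] at this
  le_l1 x := LinearMap.mkContinuous_norm_le _ (Finset.sum_nonneg fun _ _ => norm_nonneg _) _

/-- Right multiplication by `x` maps the vector `1`, of norm at most one, to `x`, and the inner
square of `x` dominates that of each coefficient. -/
lemma norm_coeff_le_norm_rmulL (x : SkewLaurent α) (g : ZAct α) : ‖x.coeff g‖ ≤ ‖rmulL α x‖ := by
  let ξ : RegularModule α := (1 : SkewLaurent α)
  have hξ : rmulL α x ξ = x := one_mul (x : SkewLaurent α)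
  have h1 : ‖ξ‖ ≤ 1 := by
    have : inner A ξ ξ = (1 : A) := by
      change ((1 : SkewLaurent α) * star (1 : SkewLaurent α)).coeff 1 = 1
      simp
    rw [CStarModule.norm_eq_sqrt_norm_inner_self (A := A), this]
    -- In the zero algebra `‖1‖` is `0` rather than `1`.
    rcases subsingleton_or_nontrivial A with h | h
    · rw [Subsingleton.elim (1 : A) 0]; simp
    · simp
  have h2 : ‖x.coeff g‖ ≤ ‖rmulL α x ξ‖ := by
    refine le_of_sq_le_sq ?_ (norm_nonneg _)
    rw [sq, ← CStarRing.norm_self_mul_star, CStarModule.norm_sq_eq A, hξ]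
    exact CStarAlgebra.norm_le_norm_of_nonneg_of_le (mul_star_self_nonneg _)
      (le_inner_self α (x : RegularModule α) g)
  exact h2.trans (((rmulL α x).le_opNorm ξ).trans (mul_le_of_le_one_right (norm_nonneg _) h1))

end RegularModule

/-- The Fourier coefficients are bounded by the norm of the full crossed product. -/
lemma SkewLaurent.norm_coeff_le (x : SkewLaurent α) (g : ZAct α) : ‖x.coeff g‖ ≤ ‖x‖ := by
  let _ := CStarAlgebra.spectralOrder A
  have := CStarAlgebra.spectralOrderedRing A
  exact (RegularModule.norm_coeff_le_norm_rmulL α x g).trans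
    (le_maxNorm α (RegularModule.isCStarSeminorm_rmulL α) x)

end RegularRepresentation

/-! ### Monomials and Fourier coefficients -/

section Monomials

variable {A : Type u} [CStarAlgebra A] (α : A ≃⋆ₐ[ℂ] A)

/-- The monomial `a uᵐ`. -/
def monom (m : ℤ) (a : A) : SkewLaurent α := SkewMonoidAlgebra.single (ZAct.of α m) a

/-- The coefficient of `uᵐ`. -/
def fcoeff (m : ℤ) : SkewLaurent α →+ A where
  toFun x := x.coeff (ZAct.of α m)
  map_zero' := rfl
  map_add' x y := by rw [SkewMonoidAlgebra.coeff_add, Finsupp.add_apply]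

variable {α}

lemma fcoeff_monom (m k : ℤ) (a : A) : fcoeff α k (monom α m a) = if k = m then a else 0 := by
  classical
  change (SkewMonoidAlgebra.single (ZAct.of α m) a).coeff (ZAct.of α k) = _
  rw [SkewMonoidAlgebra.coeff_single, Finsupp.single_apply]
  exact if_congr ⟨fun h => (Multiplicative.ofAdd.injective h).symm, fun h => by rw [h]⟩ rfl rfl

lemma fcoeff_smul (m : ℤ) (c : ℂ) (x : SkewLaurent α) : fcoeff α m (c • x) = c • fcoeff α m x := by
  change (c • x).coeff _ = c • x.coeff _
  rw [SkewMonoidAlgebra.coeff_smul, Finsupp.smul_apply]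

lemma monom_mul_monom (m k : ℤ) (a b : A) :
    monom α m a * monom α k b = monom α (m + k) (a * (α ^ m) b) :=
  SkewMonoidAlgebra.single_mul_single

lemma star_monom (m : ℤ) (a : A) : star (monom α m a) = monom α (-m) ((α ^ (-m)) (star a)) :=
  SkewLaurent.star_single α _ a

lemma monom_add (m : ℤ) (a b : A) : monom α m (a + b) = monom α m a + monom α m b :=
  SkewMonoidAlgebra.single_add _ _ _

lemma monom_zero_one : monom α 0 1 = 1 := rfl

lemma monom_pow (a : ℕ) : monom α 1 1 ^ a = monom α a 1 := by
  induction a with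
  | zero => exact pow_zero _
  | succ k ih => rw [pow_succ, ih, monom_mul_monom, map_one, one_mul, Nat.cast_succ]

lemma norm_monom_le (m : ℤ) (a : A) : ‖monom α m a‖ ≤ ‖a‖ := by
  classical
  refine ((isCStarSeminorm_maxNorm α).le_l1 _).trans ?_
  refine (Finset.sum_le_sum_of_subset_of_nonneg (t := {ZAct.of α m}) ?_ ?_).trans ?_
  · exact Finsupp.support_single_subset
  · exact fun _ _ _ => norm_nonneg _
  · rw [Finset.sum_singleton]
    change ‖fcoeff α m (monom α m a)‖ ≤ _
    rw [fcoeff_monom, if_pos rfl]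

lemma norm_fcoeff_le (m : ℤ) (x : SkewLaurent α) : ‖fcoeff α m x‖ ≤ ‖x‖ :=
  SkewLaurent.norm_coeff_le α x _

lemma SkewLaurent.ext_fcoeff {x y : SkewLaurent α} (h : ∀ m, fcoeff α m x = fcoeff α m y) : x = y :=
  SkewMonoidAlgebra.ext fun g => h g.toInt

lemma SkewLaurent.exists_bound (x : SkewLaurent α) : ∃ M : ℤ, ∀ m, M < |m| → fcoeff α m x = 0 := by
  classical
  obtain ⟨M, hM⟩ := (x.coeff.support.image fun g => |g.toInt|).bddAbove
  refine ⟨M, fun m hm => ?_⟩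
  by_contra h0
  have : |m| ≤ M := hM (Finset.mem_coe.2 (Finset.mem_image.2
    ⟨ZAct.of α m, Finsupp.mem_support_iff.2 h0, rfl⟩))
  omega

lemma fcoeff_sum_monom (M : ℤ) (f : ℤ → A) (k : ℤ) :
    fcoeff α k (∑ m ∈ Finset.Icc (-M) M, monom α m (f m)) = if |k| ≤ M then f k else 0 := by
  rw [map_sum]
  simp only [fcoeff_monom]
  rw [Finset.sum_ite_eq]
  exact if_congr (by rw [Finset.mem_Icc, abs_le]) rfl rfl

lemma SkewLaurent.eq_sum_monom {x : SkewLaurent α} {M : ℤ} (hM : ∀ m, M < |m| → fcoeff α m x = 0) :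
    x = ∑ m ∈ Finset.Icc (-M) M, monom α m (fcoeff α m x) := by
  refine SkewLaurent.ext_fcoeff fun k => ?_
  rw [fcoeff_sum_monom]
  split_ifs with h
  · rfl
  · exact hM k (not_le.1 h)

/-- An additive statement about elements of `A[ℤ]` follows from its validity for the terms. -/
lemma SkewLaurent.induction_terms {P : SkewLaurent α → Prop} (x : SkewLaurent α) (zero : P 0)
    (add : ∀ x y, P x → P y → P (x + y)) (term : ∀ m, P (monom α m (fcoeff α m x))) : P x := by
  obtain ⟨M, hM⟩ := x.exists_bound
  rw [SkewLaurent.eq_sum_monom hM]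
  exact Finset.sum_induction _ P add zero fun m _ => term m

/-! ### The subalgebra `A[ℤ]` of the crossed product -/

namespace CrossedProduct

open UniformSpace

variable (α)

/-- The canonical map `A[ℤ] → C*(ℤ, A, α)`. -/
def ofSkew : SkewLaurent α →⋆ₐ[ℂ] CrossedProduct α where
  toFun x := (x : CrossedProduct α)
  map_one' := Completion.coe_one _
  map_mul' := Completion.coe_mul
  map_zero' := Completion.coe_zero
  map_add' := Completion.coe_add
  commutes' _ := rfl
  map_star' x := (coe_star α x).symm

lemma continuous_ofSkew : Continuous (ofSkew α) := Completion.continuous_coe _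

lemma incl_eq (a : A) : incl α a = ofSkew α (monom α 0 a) := rfl

lemma u_eq : u α = ofSkew α (monom α 1 1) := rfl

lemma incl_mul_u_pow (a : A) (m : ℕ) : incl α a * u α ^ m = ofSkew α (monom α m a) := by
  rw [incl_eq, u_eq, ← map_pow, ← map_mul, monom_pow, monom_mul_monom, zero_add, zpow_zero]
  exact congrArg (fun a => ofSkew α (monom α m a)) (mul_one a)

/-- The Fourier coefficients of elements of the crossed product. -/
def coeffExt (m : ℤ) : CrossedProduct α → A := Completion.extension (fcoeff α m)

lemma uniformContinuous_fcoeff (m : ℤ) : UniformContinuous (fcoeff α m) :=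
  AddMonoidHomClass.uniformContinuous_of_bound (fcoeff α m) 1
    fun x => by rw [one_mul]; exact norm_fcoeff_le m x

lemma continuous_coeffExt (m : ℤ) : Continuous (coeffExt α m) := Completion.continuous_extension

lemma coeffExt_ofSkew (m : ℤ) (x : SkewLaurent α) : coeffExt α m (ofSkew α x) = fcoeff α m x :=
  Completion.extension_coe (uniformContinuous_fcoeff α m) x

/-- The maximal seminorm is a norm, since the coefficients are continuous for it and separate
`A[ℤ]`. -/
lemma ofSkew_injective : Function.Injective (ofSkew α) := fun x y hxy =>
  SkewLaurent.ext_fcoeff fun m => by rw [← coeffExt_ofSkew, hxy, coeffExt_ofSkew]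

lemma continuous_ofSkew_monom (m : ℤ) : Continuous fun a => ofSkew α (monom α m a) := by
  let φ : A →+ SkewLaurent α := ⟨⟨monom α m, SkewMonoidAlgebra.single_zero _⟩, monom_add m⟩
  have : Continuous φ := AddMonoidHomClass.continuous_of_bound φ 1
    fun x => by rw [one_mul]; exact norm_monom_le m x
  exact (continuous_ofSkew α).comp this

/-- A subspace of `A[ℤ]` that is defined by closed conditions on finitely many coefficients, all
others being zero, is closed in the crossed product. -/
lemma isClosed_image_ofSkew {S : Set (SkewLaurent α)} {I : ℤ → Set A} (hI : ∀ m, IsClosed (I m))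
    (hS : ∀ x, x ∈ S ↔ ∀ m, fcoeff α m x ∈ I m) {M : ℤ} (hM : ∀ m, M < |m| → I m = {0}) :
    IsClosed (ofSkew α '' S) := by
  -- On `S` the coefficients beyond `M` vanish. So the image is cut out by the equation of `a` with
  -- its Fourier sum truncated at `M` and by the conditions on the coefficients, all of which are
  -- closed.
  have : ofSkew α '' S = {a | a = ∑ m ∈ Finset.Icc (-M) M, ofSkew α (monom α m (coeffExt α m a))} ∩
      ⋂ m, {a | coeffExt α m a ∈ I m} := by
    ext a
    constructor
    · rintro ⟨x, hx, rfl⟩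
      rw [hS] at hx
      refine ⟨?_, Set.mem_iInter.2 fun m => by simpa [coeffExt_ofSkew] using hx m⟩
      have h1 : ∀ m, M < |m| → fcoeff α m x = 0 := fun m hm => by
        have := hx m
        rwa [hM m hm] at this
      simp only [Set.mem_ofPred_eq, coeffExt_ofSkew]
      rw [← map_sum, ← SkewLaurent.eq_sum_monom h1]
    · rintro ⟨h1, h2⟩
      rw [Set.mem_ofPred_eq, ← map_sum] at h1
      refine ⟨_, ?_, h1.symm⟩
      rw [hS]
      intro m
      rw [← coeffExt_ofSkew, ← h1]
      exact Set.mem_iInter.1 h2 m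
  rw [this]
  refine IsClosed.inter (isClosed_eq continuous_id ?_) (isClosed_iInter fun m =>
    (hI m).preimage (continuous_coeffExt α m))
  exact continuous_finsetSum _ fun m _ =>
    (continuous_ofSkew_monom α m).comp (continuous_coeffExt α m)

end CrossedProduct

end Monomials

/-! ### Automorphisms lying over a homeomorphism -/

section Fibers

variable {X : Type u} [TopologicalSpace X] {D : Type v} [CStarAlgebra D]
  (α : C(X, D) ≃⋆ₐ[ℂ] C(X, D)) {h : X ≃ₜ X}

/-- The *-homomorphism `D → D` with `α⁻ᵐ(f)(x) = fiberHom α m x (f (hᵐ x))`. -/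
def fiberHom (m : ℤ) (x : X) : D →⋆ₐ[ℂ] D where
  toFun d := (α ^ (-m)) (ContinuousMap.const X d) x
  map_one' := congrArg (fun f : C(X, D) => f x) (map_one (α ^ (-m)))
  map_mul' d e := congrArg (fun f : C(X, D) => f x)
    (map_mul (α ^ (-m)) (ContinuousMap.const X d) (ContinuousMap.const X e))
  map_zero' := congrArg (fun f : C(X, D) => f x) (map_zero (α ^ (-m)))
  map_add' d e := congrArg (fun f : C(X, D) => f x)
    (map_add (α ^ (-m)) (ContinuousMap.const X d) (ContinuousMap.const X e))
  commutes' c := congrArg (fun f : C(X, D) => f x)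
    ((α ^ (-m) : C(X, D) ≃⋆ₐ[ℂ] C(X, D)).toAlgEquiv.commutes c)
  map_star' d := congrArg (fun f : C(X, D) => f x) (map_star (α ^ (-m)) (ContinuousMap.const X d))

lemma fiberHom_def (m : ℤ) (x : X) (d : D) :
    fiberHom α m x d = (α ^ (-m)) (ContinuousMap.const X d) x := rfl

lemma fiberPull_eq (m : ℕ) (x : X) (d : D) : fiberPull α m x d = fiberHom α m x d := rfl

variable {α}

/-- The value of `α⁻ᵐ(f)` at `x` depends on `f` only through `f (hᵐ x)`, so `f` may be replaced by
the constant function with this value. -/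
lemma LiesOver.zpow_neg_apply (hα : LiesOver α h) (m : ℤ) (f : C(X, D)) (x : X) :
    (α ^ (-m)) f x = fiberHom α m x (f ((h ^ m) x)) := by
  obtain ⟨β, hβ⟩ := hα
  rw [fiberHom_def, hβ, hβ, neg_neg]
  rfl

lemma LiesOver.zpow_apply (hα : LiesOver α h) (m : ℤ) (f : C(X, D)) (x : X) :
    (α ^ m) f x = fiberHom α (-m) x (f ((h ^ (-m)) x)) := by
  rw [← hα.zpow_neg_apply, neg_neg]

/-- The cocycle identity of the fibre maps; it is `α⁻ᵐ α⁻ᵏ = α^{-(m+k)}` evaluated at `x`. -/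
lemma LiesOver.fiberHom_fiberHom (hα : LiesOver α h) (m k : ℤ) (x : X) (d : D) :
    fiberHom α m x (fiberHom α k ((h ^ m) x) d) = fiberHom α (m + k) x d := by
  rw [fiberHom_def α k, ← hα.zpow_neg_apply, fiberHom_def, neg_add, zpow_add]
  rfl

lemma fiberHom_zero (x : X) (d : D) : fiberHom α 0 x d = d := by
  rw [fiberHom_def, neg_zero, zpow_zero]; rfl

lemma LiesOver.fiberHom_neg_fiberHom (hα : LiesOver α h) (m : ℤ) (x : X) (d : D) :
    fiberHom α (-m) ((h ^ m) x) (fiberHom α m x d) = d := by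
  have : (h ^ (-m)) ((h ^ m) x) = x := by
    rw [← Homeomorph.mul_apply, ← zpow_add, neg_add_cancel, zpow_zero]; rfl
  have h2 := hα.fiberHom_fiberHom (-m) m ((h ^ m) x) d
  rwa [this, neg_add_cancel, fiberHom_zero] at h2

variable (α) in
-- Joint continuity: the fibre maps are contractive in `d`, and for fixed `d` they form the
-- continuous function `α⁻ᵐ(d)` of `x`.
lemma continuous_fiberHom [CompactSpace X] (m : ℤ) :
    Continuous fun z : X × D => fiberHom α m z.1 z.2 := by
  have h1 : ∀ (m : ℤ) (x : X) (d : D), ‖fiberHom α m x d‖ ≤ ‖d‖ := fun m x d =>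
    (ContinuousMap.norm_coe_le_norm _ x).trans
      ((StarAlgEquiv.norm_map (α ^ (-m)) (ContinuousMap.const X d)).trans_le
        ((ContinuousMap.norm_le _ (norm_nonneg d)).2 fun _ => le_rfl))
  refine continuous_iff_continuousAt.2 fun ⟨x, d⟩ => ?_
  rw [ContinuousAt, tendsto_iff_norm_sub_tendsto_zero]
  have h2 : Continuous fun z : X × D => ‖z.2 - d‖ +
      ‖(α ^ (-m)) (ContinuousMap.const X d) z.1 - (α ^ (-m)) (ContinuousMap.const X d) x‖ := by
    fun_prop
  refine squeeze_zero (fun _ => norm_nonneg _) (fun z => ?_) (h2.tendsto' (x, d) 0 (by simp))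
  calc ‖fiberHom α m z.1 z.2 - fiberHom α m x d‖
      = ‖fiberHom α m z.1 (z.2 - d) + (fiberHom α m z.1 d - fiberHom α m x d)‖ := by
        rw [map_sub]; congr 1; abel
    _ ≤ _ := (norm_add_le _ _).trans (add_le_add (h1 _ _ _) le_rfl)

end Fibers

/-! ### Visits to a set along the orbits of a homeomorphism -/

section Visits

variable {X : Type u} [TopologicalSpace X] (h : X ≃ₜ X) (Y : Set X)

lemma zpow_add_apply (m k : ℤ) (x : X) : (h ^ (m + k)) x = (h ^ m) ((h ^ k) x) := by
  rw [zpow_add]; rfl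

/-- The orbit of `x` visits `Y` at some time that separates the positions `p` and `q`. -/
def Separated (x : X) (p q : ℤ) : Prop :=
  ∃ s : ℤ, (h ^ s) x ∈ Y ∧ ¬ (s ≤ p ↔ s ≤ q)

variable {h Y}

lemma not_separated_self (x : X) (p : ℤ) : ¬ Separated h Y x p p := fun ⟨_, _, hs⟩ => hs Iff.rfl

lemma Separated.symm {x : X} {p q : ℤ} (hx : Separated h Y x p q) : Separated h Y x q p := by
  obtain ⟨s, hs, hn⟩ := hx
  exact ⟨s, hs, fun h' => hn h'.symm⟩

/-- A visit at time `s` cuts the integers into `t < s` and `t ≥ s`, and `r` is on one of the two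
sides. Hence non-separation is transitive; its classes are the blocks between successive visits. -/
lemma Separated.or {x : X} {p q : ℤ} (hx : Separated h Y x p q) (r : ℤ) :
    Separated h Y x p r ∨ Separated h Y x r q := by
  obtain ⟨s, hs, hn⟩ := hx
  by_cases h' : s ≤ p ↔ s ≤ r
  · exact Or.inr ⟨s, hs, fun h'' => hn (h'.trans h'')⟩
  · exact Or.inl ⟨s, hs, h'⟩

lemma separated_zpow_apply {x : X} {k p q : ℤ} :
    Separated h Y ((h ^ k) x) p q ↔ Separated h Y x (p + k) (q + k) := by
  constructor
  · rintro ⟨s, hs, hn⟩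
    refine ⟨s + k, by rwa [zpow_add_apply], by simpa using hn⟩
  · rintro ⟨s, hs, hn⟩
    refine ⟨s - k, by rwa [← zpow_add_apply, sub_add_cancel], ?_⟩
    rwa [sub_le_iff_le_add, sub_le_iff_le_add]

/-- Membership in `hʲ(Y)` is a visit at time `-j`, and `0 ≤ j < m` says precisely that `-m < -j ≤
0`. -/
lemma mem_levelUnion_iff {m : ℕ} {x : X} : x ∈ levelUnion h Y m ↔ Separated h Y x 0 (-m) := by
  simp only [levelUnion, Set.mem_iUnion, Set.mem_image]
  constructor
  · rintro ⟨j, y, hy, rfl⟩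
    refine ⟨-(j : ℕ), ?_, ?_⟩
    · rw [← zpow_natCast, ← zpow_add_apply, neg_add_cancel, zpow_zero]
      exact hy
    · have := j.2
      omega
  · rintro ⟨s, hs, hn⟩
    refine ⟨⟨(-s).toNat, by omega⟩, _, hs, ?_⟩
    rw [← zpow_natCast, ← zpow_add_apply, Int.toNat_of_nonneg (by omega), neg_add_cancel, zpow_zero]
    rfl

/-- Under a minimal homeomorphism of a compact space, all orbits visit a set with nonempty interior
with bounded gaps. -/
lemma IsMinimalHomeo.exists_visit [CompactSpace X] (hmin : IsMinimalHomeo h)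
    (hY : (interior Y).Nonempty) :
    ∃ M : ℕ, ∀ (x : X) (a : ℤ), ∃ s : ℤ, a < s ∧ s ≤ a + M ∧ (h ^ s) x ∈ Y := by
  obtain ⟨t, ht⟩ := isCompact_univ.elim_finite_subcover
    (fun n : ℤ => (h ^ n) ⁻¹' interior Y) (fun n => isOpen_interior.preimage (h ^ n).continuous)
    (fun x _ => by
      obtain ⟨_, ⟨n, rfl⟩, hy⟩ := (hmin x).exists_mem_open isOpen_interior hY
      exact Set.mem_iUnion.2 ⟨n, hy⟩)
  obtain ⟨N, hN⟩ := (t.image fun n => n.natAbs).bddAbove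
  -- The finite subcover gives a visit within distance `N` of any time. Around the time `a + N + 1`
  -- it falls into `[a + 1, a + 2N + 1]`.
  refine ⟨2 * N + 1, fun x a => ?_⟩
  obtain ⟨n, hn, hx⟩ := Set.mem_iUnion₂.1 (ht (Set.mem_univ ((h ^ (a + N + 1)) x)))
  have : n.natAbs ≤ N := hN (Finset.mem_coe.2 (Finset.mem_image_of_mem _ hn))
  refine ⟨n + (a + N + 1), by omega, by push_cast; omega, ?_⟩
  rw [zpow_add_apply]
  exact interior_subset hx

/-- This bounds the Fourier degrees of the elements of `A_Y`: a stretch longer than the gap bound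
contains a visit. -/
lemma separated_of_lt {M : ℕ} (hM : ∀ (x : X) (a : ℤ), ∃ s : ℤ, a < s ∧ s ≤ a + M ∧ (h ^ s) x ∈ Y)
    (x : X) {m : ℤ} (hm : M < |m|) : Separated h Y x 0 (-m) := by
  rcases le_or_gt m 0 with h0 | h0
  · rw [abs_of_nonpos h0] at hm
    obtain ⟨s, h1, h2, h3⟩ := hM x 0
    exact ⟨s, h3, by omega⟩
  · rw [abs_of_pos h0] at hm
    obtain ⟨s, h1, h2, h3⟩ := hM x (-m)
    exact ⟨s, h3, by omega⟩

end Visits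

/-! ### The elements of the orbit breaking subalgebra -/

section BreakingSkew

variable {X : Type u} [TopologicalSpace X] {D : Type v} [CStarAlgebra D]
  {α : C(X, D) ≃⋆ₐ[ℂ] C(X, D)} {h : X ≃ₜ X} {Y : Set X}

/-- If `0` and `-(m + k)` are separated, then so are `0` and `-m`, or `-m` and `-(m + k)`. The first
case kills `f`, the second kills `g` at `h⁻ᵐ(z)`. -/
lemma LiesOver.mul_eq_zero_of_separated (hα : LiesOver α h) {m k : ℤ} {f g : C(X, D)}
    (hf : ∀ z, Separated h Y z 0 (-m) → f z = 0) (hg : ∀ z, Separated h Y z 0 (-k) → g z = 0)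
    {z : X} (hz : Separated h Y z 0 (-(m + k))) : (f * (α ^ m) g) z = 0 := by
  rw [ContinuousMap.mul_apply, hα.zpow_apply]
  rcases hz.or (-m) with h1 | h1
  · rw [hf z h1, zero_mul]
  · rw [hg _ (separated_zpow_apply.2 (by rwa [zero_add, ← neg_add, add_comm k m])), map_zero,
      mul_zero]

variable [CompactSpace X]

variable (Y) in
/-- The finite sums `∑ fₘ uᵐ` such that `fₘ` vanishes at all points whose orbit visits `Y` between
the positions `0` and `-m`. -/
def breakingSkew (hα : LiesOver α h) : StarSubalgebra ℂ (SkewLaurent α) where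
  carrier := {x | ∀ m z, Separated h Y z 0 (-m) → fcoeff α m x z = 0}
  add_mem' {x y} hx hy m z hz := by
    rw [map_add, ContinuousMap.add_apply, hx m z hz, hy m z hz, add_zero]
  mul_mem' {x y} hx hy m z hz := by
    refine SkewLaurent.induction_terms (P := fun x => fcoeff α m (x * y) z = 0) x ?_ ?_ ?_
    · rw [zero_mul, map_zero]; rfl
    · intro x x' h1 h2
      rw [add_mul, map_add, ContinuousMap.add_apply, h1, h2, add_zero]
    intro a
    refine SkewLaurent.induction_terms
      (P := fun y => fcoeff α m (monom α a (fcoeff α a x) * y) z = 0) y ?_ ?_ ?_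
    · rw [mul_zero, map_zero]; rfl
    · intro x x' h1 h2
      rw [mul_add, map_add, ContinuousMap.add_apply, h1, h2, add_zero]
    intro b
    rw [monom_mul_monom, fcoeff_monom]
    split_ifs with h0
    · subst h0
      exact hα.mul_eq_zero_of_separated (hx a) (hy b) hz
    · rfl
  algebraMap_mem' c m z hz := by
    rw [Algebra.algebraMap_eq_smul_one, ← monom_zero_one, fcoeff_smul, fcoeff_monom, if_neg]
    · simp
    · rintro rfl
      rw [neg_zero] at hz
      exact not_separated_self _ _ hz
  star_mem' {x} hx m z hz := by
    refine SkewLaurent.induction_terms (P := fun x => fcoeff α m (star x) z = 0) x ?_ ?_ ?_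
    · rw [star_zero, map_zero]; rfl
    · intro x x' h1 h2
      rw [star_add, map_add, ContinuousMap.add_apply, h1, h2, add_zero]
    intro a
    rw [star_monom, fcoeff_monom]
    split_ifs with h0
    · subst h0
      rw [hα.zpow_neg_apply, ContinuousMap.star_apply, hx, star_zero, map_zero]
      rw [separated_zpow_apply, zero_add, neg_add_cancel]
      simpa using hz.symm
    · rfl

lemma mem_breakingSkew {hα : LiesOver α h} {x : SkewLaurent α} :
    x ∈ breakingSkew Y hα ↔ ∀ m z, Separated h Y z 0 (-m) → fcoeff α m x z = 0 := Iff.rfl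

lemma monom_mem_breakingSkew {hα : LiesOver α h} {m : ℤ} {f : C(X, D)} :
    monom α m f ∈ breakingSkew Y hα ↔ ∀ z, Separated h Y z 0 (-m) → f z = 0 := by
  rw [mem_breakingSkew]
  constructor
  · intro hf z hz
    have := hf m z hz
    rwa [fcoeff_monom, if_pos rfl] at this
  · intro hf k z hz
    rw [fcoeff_monom]
    split_ifs with h0
    · subst h0; exact hf z hz
    · rfl

/-! ### The orbit breaking subalgebra as an algebra of finite sums -/

open CrossedProduct

/-- A function can be approximated by its products with functions that vanish where it does. -/
lemma exists_tendsto_mul (f : C(X, D)) : ∃ g : ℕ → C(X, D), (∀ n x, f x = 0 → g n x = 0) ∧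
    Filter.Tendsto (fun n => f * g n) Filter.atTop (nhds f) := by
  have hpos : ∀ (n : ℕ) (x : X), 0 < ‖f x‖ + 1 / (n + 1 : ℝ) := fun n x => by positivity
  -- The factor `‖f‖ / (‖f‖ + 1/(n+1))` vanishes where `f` does, and multiplying `f` by it changes
  -- `f` by at most `1/(n+1)` in norm.
  have hc : ∀ n : ℕ, Continuous fun x => (‖f x‖ / (‖f x‖ + 1 / (n + 1 : ℝ))) • (1 : D) := fun n =>
    (Continuous.div (by fun_prop) (by fun_prop) fun x => (hpos n x).ne').smul continuous_const
  refine ⟨fun n => ⟨_, hc n⟩, fun n x hx => by simp [hx], ?_⟩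
  rw [tendsto_iff_norm_sub_tendsto_zero]
  refine squeeze_zero (fun _ => norm_nonneg _) (fun n => ?_) tendsto_one_div_add_atTop_nhds_zero_nat
  rw [ContinuousMap.norm_le _ (by positivity)]
  intro x
  have h1 : (f * (⟨_, hc n⟩ : C(X, D)) - f) x =
      -((1 / (n + 1 : ℝ)) / (‖f x‖ + 1 / (n + 1 : ℝ))) • f x := by
    change f x * ((‖f x‖ / (‖f x‖ + 1 / (n + 1 : ℝ))) • (1 : D)) - f x = _
    rw [mul_smul_comm, mul_one]
    conv_lhs => rhs; rw [← one_smul ℝ (f x)]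
    rw [← sub_smul]
    congr 1
    have := (hpos n x).ne'
    field_simp
    ring
  rw [h1, norm_smul, norm_neg, Real.norm_of_nonneg (by have := hpos n x; positivity),
    div_mul_eq_mul_div, div_le_iff₀ (hpos n x)]
  gcongr
  have : 0 ≤ 1 / (n + 1 : ℝ) := by positivity
  linarith

/-- Induction on the degree through `f g u^{m+1} = (f uᵐ)(α⁻ᵐ(g) u)`, where `f g` approximates `f`
and `g` vanishes where `f` does. For `x ∈ Y` the point `hᵐ(x)` has a visit at time `-m`, so `f`, and
with it `g`, vanishes there; thus `α⁻ᵐ(g) u` is a generator. -/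
lemma ofSkew_monom_nat_mem (hα : LiesOver α h) (m : ℕ) (f : C(X, D))
    (hf : ∀ z, Separated h Y z 0 (-m) → f z = 0) : ofSkew α (monom α m f) ∈ orbitBreaking α Y := by
  induction m generalizing f with
  | zero => exact StarSubalgebra.le_topologicalClosure _ (StarAlgebra.subset_adjoin _ _
      (Or.inl ⟨f, rfl⟩))
  | succ m ih =>
    obtain ⟨g, hg, hlim⟩ := exists_tendsto_mul f
    refine (StarSubalgebra.isClosed_topologicalClosure _).mem_of_tendsto
      (((continuous_ofSkew_monom α (m + 1 : ℕ)).tendsto f).comp hlim)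
      (Filter.Eventually.of_forall fun n => ?_)
    have h1 : monom α m f * monom α 1 ((α ^ (-(m : ℤ))) (g n)) = monom α (m + 1 : ℕ) (f * g n) := by
      rw [monom_mul_monom, Nat.cast_succ]
      congr 2
      rw [← StarAlgEquiv.mul_apply, ← zpow_add, add_neg_cancel, zpow_zero]
      rfl
    change ofSkew α (monom α (m + 1 : ℕ) (f * g n)) ∈ orbitBreaking α Y
    rw [← h1, map_mul]
    refine mul_mem (ih f fun z hz => hf z ?_) ?_
    · obtain ⟨s, hs, hn⟩ := hz
      exact ⟨s, hs, by push_cast; omega⟩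
    · refine StarSubalgebra.le_topologicalClosure _ (StarAlgebra.subset_adjoin _ _
        (Or.inr ⟨(α ^ (-(m : ℤ))) (g n), fun x hx => ?_, ?_⟩))
      · rw [hα.zpow_neg_apply, hg, map_zero]
        refine hf _ (separated_zpow_apply.2 ⟨0, by rwa [zpow_zero], ?_⟩)
        push_cast; omega
      · simpa using (incl_mul_u_pow α ((α ^ (-(m : ℤ))) (g n)) 1).symm

/-- The orbit breaking subalgebra consists of finite sums `∑ fₘ uᵐ`. -/
lemma orbitBreaking_eq_map (hα : LiesOver α h) (hY : ∃ M : ℕ, ∀ (x : X) (a : ℤ),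
    ∃ s : ℤ, a < s ∧ s ≤ a + M ∧ (h ^ s) x ∈ Y) :
    orbitBreaking α Y = (breakingSkew Y hα).map (ofSkew α) := by
  apply le_antisymm
  · refine StarSubalgebra.topologicalClosure_minimal (StarAlgebra.adjoin_le ?_) ?_
    · rintro _ (⟨f, rfl⟩ | ⟨f, hf, rfl⟩)
      · refine ⟨monom α 0 f, monom_mem_breakingSkew.2 fun z hz => ?_, rfl⟩
        rw [neg_zero] at hz
        exact absurd hz (not_separated_self _ _)
      · refine ⟨monom α 1 f, monom_mem_breakingSkew.2 fun z hz => hf z ?_, ?_⟩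
        · obtain ⟨s, hs, hn⟩ := hz
          obtain rfl : s = 0 := by omega
          rwa [zpow_zero] at hs
        · simpa using (incl_mul_u_pow α f 1).symm
    -- The finite sums are already closed: the gap bound `M` leaves only finitely many degrees, and
    -- each coefficient satisfies a closed condition.
    · obtain ⟨M, hM⟩ := hY
      refine isClosed_image_ofSkew α (S := breakingSkew Y hα) (M := M)
        (I := fun m => {f : C(X, D) | ∀ z, Separated h Y z 0 (-m) → f z = 0}) ?_ ?_ ?_
      · intro m
        simp only [Set.ofPred_forall]
        exact isClosed_iInter fun z => isClosed_iInter fun _ =>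
          isClosed_eq (continuous_eval_const z) continuous_const
      · exact fun x => Iff.rfl
      · intro m hm
        refine Set.eq_singleton_iff_unique_mem.2 ⟨fun _ _ => rfl, fun f hf => ?_⟩
        ext z
        exact hf z (separated_of_lt hM z hm)
  · rintro _ ⟨x, hx, rfl⟩
    change ofSkew α x ∈ _
    refine SkewLaurent.induction_terms (P := fun x => ofSkew α x ∈ orbitBreaking α Y) x ?_ ?_ ?_
    · rw [map_zero]; exact zero_mem _
    · intro x y h1 h2
      rw [map_add]; exact add_mem h1 h2
    intro m
    have h1 := monom_mem_breakingSkew (hα := hα).2 (hx m)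
    obtain ⟨k, rfl | rfl⟩ := m.eq_nat_or_neg
    · exact ofSkew_monom_nat_mem hα k _ (monom_mem_breakingSkew.1 h1)
    -- A term of negative degree is the adjoint of one of positive degree satisfying the same kind
    -- of vanishing condition.
    · rw [← star_star (monom α _ _), map_star]
      refine star_mem ?_
      have h2 := star_mem h1
      rw [star_monom, neg_neg] at h2 ⊢
      exact ofSkew_monom_nat_mem hα k _ (monom_mem_breakingSkew.1 h2)

lemma ofSkew_mem_orbitBreaking (hα : LiesOver α h) (hY : ∃ M : ℕ, ∀ (x : X) (a : ℤ),
    ∃ s : ℤ, a < s ∧ s ≤ a + M ∧ (h ^ s) x ∈ Y) {x : SkewLaurent α} (hx : x ∈ breakingSkew Y hα) :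
    ofSkew α x ∈ orbitBreaking α Y := by
  rw [orbitBreaking_eq_map hα hY]
  exact ⟨x, hx, rfl⟩

/-- The orbit breaking subalgebra, identified with an algebra of finite sums. -/
def breakingEquiv (hα : LiesOver α h) (hY : ∃ M : ℕ, ∀ (x : X) (a : ℤ),
    ∃ s : ℤ, a < s ∧ s ≤ a + M ∧ (h ^ s) x ∈ Y) : breakingSkew Y hα ≃⋆ₐ[ℂ] orbitBreaking α Y :=
  StarAlgEquiv.ofBijective
    (((ofSkew α).comp (breakingSkew Y hα).subtype).codRestrict (orbitBreaking α Y)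
      fun x => ofSkew_mem_orbitBreaking hα hY x.2)
    ⟨fun x y hxy => Subtype.ext (ofSkew_injective α (congrArg Subtype.val hxy)), fun a => by
      obtain ⟨a, ha⟩ := a
      have ha' := ha
      rw [orbitBreaking_eq_map hα hY] at ha'
      obtain ⟨x, hx, rfl⟩ := ha'
      exact ⟨⟨x, hx⟩, rfl⟩⟩

end BreakingSkew

/-! ### Covering dimension -/

section CoveringDim

variable {X : Type u} [TopologicalSpace X] {n : ℕ}

/-- Covering dimension at most `n`, in terms of shrinkings of indexed covers. -/
lemma coveringDimLE_iff : CoveringDimLE X n ↔ ∀ (ι : Type u) [Finite ι] (U : ι → Set X),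
    (∀ i, IsOpen (U i)) → ⋃ i, U i = Set.univ → ∃ V : ι → Set X, (∀ i, IsOpen (V i)) ∧
      ⋃ i, V i = Set.univ ∧ (∀ i, V i ⊆ U i) ∧
        ∀ F : Finset ι, F.card = n + 2 → ⋂ i ∈ F, V i = ∅ := by
  classical
  constructor
  · intro H ι _ U hU hcov
    obtain ⟨V, hV, hVcov, href, hord⟩ := H (Set.range U) (Set.finite_range U)
      (by rintro _ ⟨i, rfl⟩; exact hU i) (by rw [Set.sUnion_range, hcov])
    have : ∀ s : V, ∃ i, (s : Set X) ⊆ U i := fun s => by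
      obtain ⟨_, ⟨i, rfl⟩, hi⟩ := href s s.2
      exact ⟨i, hi⟩
    choose idx hidx using this
    -- All members of the refinement that are assigned to the same index are merged.
    refine ⟨fun i => ⋃ s : {s : V // idx s = i}, (s : Set X), fun i => isOpen_iUnion fun s =>
      hV _ s.1.2, ?_, ?_, ?_⟩
    · refine Set.eq_univ_of_forall fun x => ?_
      obtain ⟨s, hs, hx⟩ := Set.mem_sUnion.1 (hVcov ▸ Set.mem_univ x)
      exact Set.mem_iUnion.2 ⟨idx ⟨s, hs⟩, Set.mem_iUnion.2 ⟨⟨⟨s, hs⟩, rfl⟩, hx⟩⟩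
    · intro i
      refine Set.iUnion_subset fun s => ?_
      obtain ⟨s, rfl⟩ := s
      exact hidx s
    · intro F hF
      refine Set.eq_empty_of_forall_notMem fun x hx => ?_
      simp only [Set.mem_iInter, Set.mem_iUnion] at hx
      choose s hs using hx
      -- Each member of the refinement is assigned to one index only, so the members chosen for
      -- distinct indices are distinct.
      have hinj : Function.Injective fun i : F => ((s i i.2).1 : Set X) := fun i j hij => by
        have := Subtype.ext (a1 := (s i i.2).1) (a2 := (s j j.2).1) hij
        exact Subtype.ext ((s i i.2).2.symm.trans ((congrArg idx this).trans (s j j.2).2))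
      have h0 := hord (F.attach.image fun i : F => ((s i i.2).1 : Set X))
        (by
          intro t ht
          obtain ⟨i, -, rfl⟩ := Finset.mem_image.1 (Finset.mem_coe.1 ht)
          exact (s i i.2).1.2)
        (by rw [Finset.card_image_of_injective _ hinj, Finset.card_attach, hF])
      refine Set.notMem_empty x (h0 ▸ ?_)
      rintro t ht
      obtain ⟨i, -, rfl⟩ := Finset.mem_image.1 (Finset.mem_coe.1 ht)
      exact hs i i.2
  · intro H U hfin hU hcov
    have := hfin.to_subtype
    obtain ⟨V, hV, hVcov, href, hord⟩ := H U (fun s => s) (fun s => hU s s.2)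
      (by rw [← Set.sUnion_eq_iUnion, hcov])
    refine ⟨Set.range V, by rintro _ ⟨i, rfl⟩; exact hV i, by rw [Set.sUnion_range, hVcov],
      by rintro _ ⟨i, rfl⟩; exact ⟨i, i.2, href i⟩, fun F hF hcard => ?_⟩
    have : ∀ s : F, ∃ i, V i = s := fun s => hF s.2
    choose idx hidx using this
    have hinj : Function.Injective idx := fun s t hst => Subtype.ext (by rw [← hidx, hst, hidx])
    have h0 := hord (F.attach.image idx)
      (by rw [Finset.card_image_of_injective _ hinj, Finset.card_attach, hcard])
    refine Set.eq_empty_of_forall_notMem fun x hx => Set.notMem_empty x (h0 ▸ ?_)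
    simp only [Set.mem_iInter]
    intro i hi
    obtain ⟨s, -, rfl⟩ := Finset.mem_image.1 hi
    rw [hidx]
    exact hx s s.2

lemma CoveringDimLE.mono {m : ℕ} (hX : CoveringDimLE X n) (hnm : n ≤ m) : CoveringDimLE X m := by
  intro U hfin hU hcov
  obtain ⟨V, hV, hVcov, href, hord⟩ := hX U hfin hU hcov
  refine ⟨V, hV, hVcov, href, fun F hF hcard => ?_⟩
  obtain ⟨F', hF', hcard'⟩ := Finset.exists_subset_card_eq (s := F) (n := n + 2) (by omega)
  exact Set.subset_eq_empty (Set.sInter_subset_sInter (Finset.coe_subset.2 hF'))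
    (hord F' ((Finset.coe_subset.2 hF').trans hF) hcard')

/-- An open cover of the closed subspace extends to the whole space by adding the complement of the
subspace to each member. -/
lemma CoveringDimLE.of_isClosedEmbedding {Z : Type u} [TopologicalSpace Z] {f : Z → X}
    (hf : Topology.IsClosedEmbedding f) (hX : CoveringDimLE X n) : CoveringDimLE Z n := by
  rw [coveringDimLE_iff] at hX ⊢
  intro ι _ U hU hcov
  choose O hO hOU using fun i => hf.isInducing.isOpen_iff.1 (hU i)
  -- If `Z` is empty there may be no index at all, and then no member to carry the complement of the
  -- image.
  rcases isEmpty_or_nonempty Z with hZ | hZ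
  · exact ⟨U, hU, hcov, fun i => subset_rfl, fun F _ => Set.eq_empty_of_isEmpty _⟩
  obtain ⟨i₀, -⟩ := Set.mem_iUnion.1 (hcov ▸ Set.mem_univ hZ.some)
  obtain ⟨V, hV, hVcov, href, hord⟩ := hX ι (fun i => O i ∪ (Set.range f)ᶜ)
    (fun i => (hO i).union hf.isClosed_range.isOpen_compl) (by
      refine Set.eq_univ_of_forall fun x => ?_
      by_cases hx : x ∈ Set.range f
      · obtain ⟨z, rfl⟩ := hx
        obtain ⟨i, hi⟩ := Set.mem_iUnion.1 (hcov ▸ Set.mem_univ z)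
        exact Set.mem_iUnion.2 ⟨i, Or.inl (by rwa [← hOU] at hi)⟩
      · exact Set.mem_iUnion.2 ⟨i₀, Or.inr hx⟩)
  refine ⟨fun i => f ⁻¹' V i, fun i => (hV i).preimage hf.continuous, ?_, ?_, ?_⟩
  · rw [← Set.preimage_iUnion, hVcov, Set.preimage_univ]
  · intro i z hz
    rw [← hOU]
    exact (href i hz).resolve_right fun h' => h' ⟨z, rfl⟩
  · intro F hF
    rw [← Set.preimage_iInter₂, hord F hF, Set.preimage_empty]

/-- A finite open cover has a shrinking of order at most `n` on a closed subset of dimension at most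
`n`. -/
lemma CoveringDimLE.exists_shrinking {C : Set X} (hC : IsClosed C) (hn : CoveringDimLE C n)
    {ι : Type u} [Finite ι] {U : ι → Set X} (hU : ∀ i, IsOpen (U i)) (hcov : ⋃ i, U i = Set.univ) :
    ∃ V : ι → Set X, (∀ i, IsOpen (V i)) ∧ ⋃ i, V i = Set.univ ∧ (∀ i, V i ⊆ U i) ∧
      ∀ F : Finset ι, F.card = n + 2 → C ∩ ⋂ i ∈ F, V i = ∅ := by
  obtain ⟨W, hW, hWcov, href, hord⟩ := coveringDimLE_iff.1 hn ι (fun i => Subtype.val ⁻¹' U i)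
    (fun i => (hU i).preimage continuous_subtype_val)
    (by rw [← Set.preimage_iUnion, hcov, Set.preimage_univ])
  choose O hO hOW using fun i => isOpen_induced_iff.1 (hW i)
  -- The cover is shrunk on `C` only and left as it is off `C`.
  refine ⟨fun i => U i ∩ (O i ∪ Cᶜ), fun i => (hU i).inter ((hO i).union hC.isOpen_compl),
    ?_, fun i => Set.inter_subset_left, fun F hF => ?_⟩
  · refine Set.eq_univ_of_forall fun x => Set.mem_iUnion.2 ?_
    by_cases hx : x ∈ C
    · obtain ⟨i, hi⟩ := Set.mem_iUnion.1 (hWcov ▸ Set.mem_univ (⟨x, hx⟩ : C))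
      exact ⟨i, href i hi, Or.inl (by rwa [← hOW] at hi)⟩
    · obtain ⟨i, hi⟩ := Set.mem_iUnion.1 (hcov ▸ Set.mem_univ x)
      exact ⟨i, hi, Or.inr hx⟩
  · refine Set.eq_empty_of_forall_notMem fun x hx => ?_
    refine Set.notMem_empty (⟨x, hx.1⟩ : C) (hord F hF ▸ ?_)
    have h2 := hx.2
    simp only [Set.mem_iInter] at h2 ⊢
    intro i hi
    rw [← hOW]
    exact (h2 i hi).2.resolve_right fun h' => h' hx.1

/-- The finite closed sum theorem. -/
lemma CoveringDimLE.of_finite_closed_cover {κ : Type*} [Finite κ] {C : κ → Set X}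
    (hC : ∀ k, IsClosed (C k)) (hcov : ⋃ k, C k = Set.univ) (hn : ∀ k, CoveringDimLE (C k) n) :
    CoveringDimLE X n := by
  classical
  have := Fintype.ofFinite κ
  rw [coveringDimLE_iff]
  intro ι _ U hU hUcov
  -- The closed pieces are treated one at a time; further shrinking preserves the order bounds
  -- already achieved on earlier pieces.
  have key : ∀ s : Finset κ, ∃ V : ι → Set X, (∀ i, IsOpen (V i)) ∧ ⋃ i, V i = Set.univ ∧
      (∀ i, V i ⊆ U i) ∧ ∀ k ∈ s, ∀ F : Finset ι, F.card = n + 2 → C k ∩ ⋂ i ∈ F, V i = ∅ := by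
    intro s
    induction s using Finset.induction_on with
    | empty => exact ⟨U, hU, hUcov, fun i => subset_rfl, by simp⟩
    | insert k s hk ih =>
      obtain ⟨V, hV, hVcov, hVU, hord⟩ := ih
      obtain ⟨W, hW, hWcov, hWV, hord'⟩ := (hn k).exists_shrinking (hC k) hV hVcov
      refine ⟨W, hW, hWcov, fun i => (hWV i).trans (hVU i), fun k' hk' F hF => ?_⟩
      rcases Finset.mem_insert.1 hk' with rfl | hk'
      · exact hord' F hF
      · exact Set.subset_eq_empty (Set.inter_subset_inter_right _
          (Set.iInter₂_mono fun i _ => hWV i)) (hord k' hk' F hF)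
  obtain ⟨V, hV, hVcov, hVU, hord⟩ := key Finset.univ
  refine ⟨V, hV, hVcov, hVU, fun F hF => Set.eq_empty_of_forall_notMem fun x hx => ?_⟩
  obtain ⟨k, hk⟩ := Set.mem_iUnion.1 (hcov ▸ Set.mem_univ x)
  exact Set.notMem_empty x (hord k (Finset.mem_univ k) F hF ▸ ⟨hk, hx⟩)

lemma coveringDim_le_natCast_iff [Nonempty X] :
    coveringDim X ≤ ((n : ℕ∞) : WithBot ℕ∞) ↔ CoveringDimLE X n := by
  constructor
  · intro hX
    -- Passing to a strict inequality with `n + 1` produces a member of the set below `n + 1`,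
    -- without knowing that the infimum is attained.
    have h1 : coveringDim X < (((n + 1 : ℕ) : ℕ∞) : WithBot ℕ∞) :=
      hX.trans_lt (WithBot.coe_lt_coe.2 (Nat.cast_lt.2 n.lt_succ_self))
    obtain ⟨d, hd, hdn⟩ := sInf_lt_iff.1 h1
    obtain ⟨m, rfl, hm⟩ := hd.resolve_left (not_isEmpty_of_nonempty X)
    exact hm.mono (Nat.lt_succ_iff.1 (Nat.cast_lt.1 (WithBot.coe_lt_coe.1 hdn)))
  · exact fun hX => sInf_le (Or.inr ⟨n, rfl, hX⟩)

lemma coveringDim_nonneg [Nonempty X] : 0 ≤ coveringDim X := by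
  refine le_sInf fun d hd => ?_
  obtain ⟨m, rfl, -⟩ := hd.resolve_left (not_isEmpty_of_nonempty X)
  exact WithBot.coe_le_coe.2 bot_le

/-- A space that is covered by finitely many closed copies of nonempty closed subspaces has the
largest of their covering dimensions. -/
lemma iSup_coveringDim_eq {κ ι : Type*} [Finite κ] [Nonempty ι] {B : ι → Set X}
    (hB : ∀ i, IsClosed (B i)) (hne : ∀ i, (B i).Nonempty) {C : κ → Set X} {idx : κ → ι}
    (e : ∀ k, B (idx k) ≃ₜ C k) (hC : ∀ k, IsClosed (C k)) (hcov : ⋃ k, C k = Set.univ) :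
    ⨆ i, coveringDim (B i) = coveringDim X := by
  have hne' : ∀ i, Nonempty (B i) := fun i => (hne i).to_subtype
  have hX : Nonempty X := (hne (Classical.arbitrary ι)).to_type
  apply le_antisymm
  · refine iSup_le fun i => le_sInf fun d hd => ?_
    obtain ⟨m, rfl, hm⟩ := hd.resolve_left (not_isEmpty_of_nonempty X)
    exact coveringDim_le_natCast_iff.2 (hm.of_isClosedEmbedding (hB i).isClosedEmbedding_subtypeVal)
  · have h0 : 0 ≤ ⨆ i, coveringDim (B i) :=
      coveringDim_nonneg.trans (le_iSup (fun i => coveringDim (B i)) (Classical.arbitrary ι))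
    have hle : ∀ i, coveringDim (B i) ≤ ⨆ i, coveringDim (B i) := le_iSup _
    -- The supremum is `⊥`, `⊤` or a natural number. Nonemptiness excludes `⊥`, and the sum theorem
    -- handles the last case.
    generalize ⨆ i, coveringDim (B i) = s at h0 hle
    induction s with
    | bot => exact absurd h0 (by decide)
    | coe t =>
      induction t with
      | top => exact le_top
      | coe m =>
        refine coveringDim_le_natCast_iff.2 (CoveringDimLE.of_finite_closed_cover hC hcov
          fun k => ?_)
        exact (coveringDim_le_natCast_iff.1 (hle (idx k))).of_isClosedEmbedding
          (e k).symm.isClosedEmbedding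

end CoveringDim

/-! ### Return times and towers -/

section Towers

variable {X : Type u} [TopologicalSpace X]

/-- `Y` is closed, all orbits visit `Y` with bounded gaps, and `n` enumerates the return times. -/
structure IsTowerSystem (h : X ≃ₜ X) (Y : Set X) {l : ℕ} (n : Fin (l + 1) → ℕ) : Prop where
  isClosed : IsClosed Y
  exists_visit : ∃ M : ℕ, ∀ (x : X) (a : ℤ), ∃ s : ℤ, a < s ∧ s ≤ a + M ∧ (h ^ s) x ∈ Y
  strictMono : StrictMono n
  range_eq : Set.range n = returnTime h Y '' Y

/-- The last time at most `0` at which the orbit of `x` visits `Y`. -/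
def lastVisit (h : X ≃ₜ X) (Y : Set X) (x : X) : ℤ :=
  open Classical in if H : ∃ s : ℤ, (s ≤ 0 ∧ (h ^ s) x ∈ Y) ∧ ∀ t : ℤ, t ≤ 0 ∧ (h ^ t) x ∈ Y → t ≤ s
  then H.choose else 0

/-- The index of the return time of `y`. -/
def towerIndex (h : X ≃ₜ X) (Y : Set X) {l : ℕ} (n : Fin (l + 1) → ℕ) (y : X) : Fin (l + 1) :=
  open Classical in if H : ∃ k, n k = returnTime h Y y then H.choose else 0

variable {h : X ≃ₜ X} {Y : Set X} {l : ℕ} {n : Fin (l + 1) → ℕ}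

lemma towerBase_subset (hY : IsClosed Y) (N : ℕ) : towerBase h Y N ⊆ Y :=
  closure_minimal (fun _ hy => hy.1) hY

lemma isClosed_towerBase (N : ℕ) : IsClosed (towerBase h Y N) := isClosed_closure

lemma separated_of_notMem {N : ℕ} {y : X} (hy : y ∈ Y) (hN : (h ^ (N : ℤ)) y ∈ Y) {p q : ℤ}
    (hp : 0 ≤ p) (hpN : p < N) (hq : ¬ (0 ≤ q ∧ q < N)) : Separated h Y y p q := by
  by_cases h0 : 0 ≤ q
  · exact ⟨N, hN, by omega⟩
  · exact ⟨0, by rwa [zpow_zero], by omega⟩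

namespace IsTowerSystem

variable (T : IsTowerSystem h Y n)
include T

lemma exists_return (y : X) : ∃ m : ℕ, 1 ≤ m ∧ (h ^ m) y ∈ Y := by
  obtain ⟨M, hM⟩ := T.exists_visit
  obtain ⟨s, h1, h2, h3⟩ := hM y 0
  refine ⟨s.toNat, by omega, ?_⟩
  rwa [← zpow_natCast, Int.toNat_of_nonneg h1.le]

lemma one_le_returnTime (y : X) : 1 ≤ returnTime h Y y := (Nat.sInf_mem (T.exists_return y)).1

lemma zpow_returnTime_mem (y : X) : (h ^ (returnTime h Y y : ℤ)) y ∈ Y := by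
  rw [zpow_natCast]
  exact (Nat.sInf_mem (T.exists_return y)).2

omit T in
lemma _root_.OrbitBreaking.returnTime_le {y : X} {s : ℤ} (hs : 0 < s) (hy : (h ^ s) y ∈ Y) :
    (returnTime h Y y : ℤ) ≤ s := by
  have : returnTime h Y y ≤ s.toNat := Nat.sInf_le
    ⟨by omega, by rwa [← zpow_natCast, Int.toNat_of_nonneg hs.le]⟩
  omega

lemma size_index {y : X} (hy : y ∈ Y) : n (towerIndex h Y n y) = returnTime h Y y := by
  have H : ∃ k, n k = returnTime h Y y := by
    have : returnTime h Y y ∈ Set.range n := T.range_eq ▸ ⟨y, hy, rfl⟩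
    exact this
  rw [towerIndex, dif_pos H]
  exact H.choose_spec

lemma exists_mem_returnTime_eq (k : Fin (l + 1)) : ∃ y ∈ Y, returnTime h Y y = n k := by
  have : n k ∈ returnTime h Y '' Y := T.range_eq ▸ ⟨k, rfl⟩
  exact this

lemma one_le_size (k : Fin (l + 1)) : 1 ≤ n k := by
  obtain ⟨y, -, hk⟩ := T.exists_mem_returnTime_eq k
  exact hk ▸ T.one_le_returnTime y

lemma towerBase_nonempty (k : Fin (l + 1)) : (towerBase h Y (n k)).Nonempty := by
  obtain ⟨y, hy, hk⟩ := T.exists_mem_returnTime_eq k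
  exact ⟨y, subset_closure ⟨hy, hk⟩⟩

lemma mem_towerBase_index {y : X} (hy : y ∈ Y) :
    y ∈ towerBase h Y (n (towerIndex h Y n y)) :=
  subset_closure ⟨hy, (T.size_index hy).symm⟩

lemma mem_of_mem_towerBase {N : ℕ} {y : X} (hy : y ∈ towerBase h Y N) : y ∈ Y :=
  towerBase_subset T.isClosed N hy

/-- `hᴺ(y) ∈ Y` is a closed condition and passes to the closure. `N` need not remain the first
return time of limit points; by this lemma, that time can only drop. -/
lemma zpow_mem_of_mem_towerBase {N : ℕ} {y : X} (hy : y ∈ towerBase h Y N) :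
    (h ^ (N : ℤ)) y ∈ Y := by
  have : towerBase h Y N ⊆ (h ^ (N : ℤ)) ⁻¹' Y := by
    refine closure_minimal ?_ (T.isClosed.preimage (h ^ (N : ℤ)).continuous)
    rintro z ⟨-, rfl⟩
    exact T.zpow_returnTime_mem z
  exact this hy

lemma index_le_of_mem_towerBase {k : Fin (l + 1)} {y : X} (hy : y ∈ towerBase h Y (n k)) :
    towerIndex h Y n y ≤ k := by
  rw [← T.strictMono.le_iff_le, T.size_index (T.mem_of_mem_towerBase hy), ← Nat.cast_le (α := ℤ)]
  exact returnTime_le (by have := T.one_le_size k; omega) (T.zpow_mem_of_mem_towerBase hy)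

lemma lastVisit_spec (x : X) : lastVisit h Y x ≤ 0 ∧ (h ^ lastVisit h Y x) x ∈ Y ∧
    ∀ t : ℤ, t ≤ 0 → (h ^ t) x ∈ Y → t ≤ lastVisit h Y x := by
  have H : ∃ s : ℤ, (s ≤ 0 ∧ (h ^ s) x ∈ Y) ∧ ∀ t : ℤ, t ≤ 0 ∧ (h ^ t) x ∈ Y → t ≤ s := by
    obtain ⟨M, hM⟩ := T.exists_visit
    obtain ⟨s, h1, h2, h3⟩ := hM x (-M)
    exact Int.exists_greatest_of_bdd ⟨0, fun t ht => ht.1⟩ ⟨s, by omega, h3⟩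
  rw [lastVisit, dif_pos H]
  exact ⟨H.choose_spec.1.1, H.choose_spec.1.2, fun t h1 h2 => H.choose_spec.2 t ⟨h1, h2⟩⟩

lemma lastVisit_eq {x : X} {s : ℤ} (h0 : s ≤ 0) (hs : (h ^ s) x ∈ Y)
    (hlast : ∀ t : ℤ, s < t → t ≤ 0 → (h ^ t) x ∉ Y) : lastVisit h Y x = s := by
  obtain ⟨h1, h2, h3⟩ := T.lastVisit_spec x
  refine le_antisymm ?_ (h3 s h0 hs)
  by_contra hlt
  exact hlast _ (not_le.1 hlt) h1 h2

/-- Every position `p` of an orbit lies in a unique interval `[s, s + N)` between successive visits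
to `Y`. -/
lemma exists_block (x : X) (p : ℤ) : ∃ s : ℤ, s ≤ p ∧ (h ^ s) x ∈ Y ∧
    p < s + n (towerIndex h Y n ((h ^ s) x)) ∧
    (h ^ (s + n (towerIndex h Y n ((h ^ s) x)))) x ∈ Y ∧
    (∀ t, (h ^ t) x ∈ Y → t ≤ s ∨ s + n (towerIndex h Y n ((h ^ s) x)) ≤ t) ∧
    ∀ q, s ≤ q → q < s + n (towerIndex h Y n ((h ^ s) x)) →
      lastVisit h Y ((h ^ q) x) = s - q := by
  obtain ⟨h1, h2, h3⟩ := T.lastVisit_spec ((h ^ p) x)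
  set s := lastVisit h Y ((h ^ p) x) + p with hs
  rw [← zpow_add_apply, ← hs] at h2
  have hsize := T.size_index h2
  have hnext : ∀ t, (h ^ t) x ∈ Y → t ≤ s ∨ s + n (towerIndex h Y n ((h ^ s) x)) ≤ t := by
    intro t ht
    by_contra! hc
    have : (h ^ (t - s)) ((h ^ s) x) ∈ Y := by rwa [← zpow_add_apply, sub_add_cancel]
    have := returnTime_le (by omega) this
    omega
  have hret : (h ^ (s + n (towerIndex h Y n ((h ^ s) x)))) x ∈ Y := by
    rw [add_comm, zpow_add_apply, hsize]
    exact T.zpow_returnTime_mem _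
  have hp : p < s + n (towerIndex h Y n ((h ^ s) x)) := by
    by_contra! hc
    have h5 := h3 (s + n (towerIndex h Y n ((h ^ s) x)) - p) (by omega)
      (by rwa [← zpow_add_apply, sub_add_cancel])
    have := T.one_le_size (towerIndex h Y n ((h ^ s) x))
    omega
  refine ⟨s, by omega, h2, hp, hret, hnext, fun q hq1 hq2 => T.lastVisit_eq (by omega)
    (by rwa [← zpow_add_apply, sub_add_cancel]) fun t ht1 ht2 ht => ?_⟩
  rw [← zpow_add_apply] at ht
  have := hnext _ ht
  omega

end IsTowerSystem

end Towers

/-! ### The tower map -/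

section TowerHom

variable {X : Type u} [TopologicalSpace X] {D : Type v} [CStarAlgebra D]
  {α : C(X, D) ≃⋆ₐ[ℂ] C(X, D)} {h : X ≃ₜ X} {Y : Set X} {l : ℕ} {n : Fin (l + 1) → ℕ}

lemma LiesOver.zpow_neg_apply_eq_zero (hα : LiesOver α h) {p m : ℤ} {f : C(X, D)} {y : X}
    (hf : ∀ z, Separated h Y z 0 (-m) → f z = 0) (hy : Separated h Y y p (p - m)) :
    (α ^ (-p)) f y = 0 := by
  rw [hα.zpow_neg_apply, hf, map_zero]
  rw [separated_zpow_apply, zero_add, neg_add_eq_sub]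
  exact hy

/-- An entrywise substitute for the C*-identity: the diagonal entries of `a a*` are sums of the
positive elements `aᵢⱼ aᵢⱼ*`. -/
lemma eq_zero_of_mul_star_self_eq_zero {B : Set X} {N : ℕ} {a : MatFun B N D}
    (ha : a * star a = 0) : a = 0 := by
  let _ := CStarAlgebra.spectralOrder D
  have := CStarAlgebra.spectralOrderedRing D
  ext y i j
  have h1 := congrArg (fun b : MatFun B N D => b y i i) ha
  simp only [ContinuousMap.mul_apply, Matrix.mul_apply, ContinuousMap.star_apply,
    Matrix.star_apply, ContinuousMap.zero_apply, Matrix.zero_apply] at h1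
  rw [Finset.sum_eq_zero_iff_of_nonneg fun _ _ => mul_star_self_nonneg _] at h1
  exact (CStarRing.mul_star_self_eq_zero_iff _).1 (h1 j (Finset.mem_univ j))

lemma shift_pow_apply (B : Set X) (N : ℕ) (m : ℕ) (hm : 0 < N) (y : B) (i j : Fin N) :
    (shift B N D ^ m) y i j = if (i : ℕ) = (j + m) % N then 1 else 0 := by
  induction m generalizing i j with
  | zero =>
    rw [pow_zero, ContinuousMap.one_apply, Matrix.one_apply, add_zero, Nat.mod_eq_of_lt j.2]
    exact if_congr Fin.ext_iff rfl rfl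
  | succ m ih =>
    rw [pow_succ, ContinuousMap.mul_apply, Matrix.mul_apply]
    simp only [ih]
    rw [Finset.sum_eq_single (⟨(j + 1) % N, Nat.mod_lt _ hm⟩ : Fin N)]
    · simp [shift, add_assoc, add_comm 1 m]
    · intro t _ ht
      have : (t : ℕ) ≠ (j + 1) % N := fun h' => ht (Fin.ext h')
      simp [shift, this]
    · exact fun h' => absurd (Finset.mem_univ _) h'

variable [CompactSpace X]

lemma star_towerDiag (B : Set X) (N : ℕ) (f : C(X, D)) :
    star (towerDiag α B N f) = towerDiag α B N (star f) := by
  ext y i j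
  rw [ContinuousMap.star_apply]
  change (Matrix.diagonal fun i : Fin N => (α ^ (-((i : ℕ) : ℤ))) f y)ᴴ i j =
    Matrix.diagonal (fun i : Fin N => (α ^ (-((i : ℕ) : ℤ))) (star f) y) i j
  rw [Matrix.diagonal_conjTranspose]
  congr 2
  funext i
  rw [map_star]
  rfl

/-- For terms of degrees `a` and `b` only the intermediate index `t = i - a` contributes. If it
falls outside `[0, N)`, the visit at time `0` or `N` separates `i` from `i - a`, so the left
coefficient vanishes and nothing is lost by truncating the sum. -/
lemma sum_entries_mul (hα : LiesOver α h) {x x' : SkewLaurent α}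
    (hx : ∀ m z, Separated h Y z 0 (-m) → fcoeff α m x z = 0) {N : ℕ} {y : X} (hy : y ∈ Y)
    (hN : (h ^ (N : ℤ)) y ∈ Y)
    (i j : Fin N) : (α ^ (-(i : ℤ))) (fcoeff α (i - j) (x * x')) y =
      ∑ t : Fin N, (α ^ (-(i : ℤ))) (fcoeff α (i - t) x) y *
        (α ^ (-(t : ℤ))) (fcoeff α (t - j) x') y := by
  refine SkewLaurent.induction_terms (P := fun x => (α ^ (-(i : ℤ))) (fcoeff α (i - j) (x * x')) y =
      ∑ t : Fin N, (α ^ (-(i : ℤ))) (fcoeff α (i - t) x) y *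
        (α ^ (-(t : ℤ))) (fcoeff α (t - j) x') y) x ?_ ?_ fun a => ?_
  · simp
  · intro x z h1 h2
    simp only [add_mul, map_add, ContinuousMap.add_apply, h1, h2, Finset.sum_add_distrib]
  refine SkewLaurent.induction_terms (P := fun x' =>
    (α ^ (-(i : ℤ))) (fcoeff α (i - j) (monom α a (fcoeff α a x) * x')) y =
      ∑ t : Fin N, (α ^ (-(i : ℤ))) (fcoeff α (i - t) (monom α a (fcoeff α a x))) y *
        (α ^ (-(t : ℤ))) (fcoeff α (t - j) x') y) x' ?_ ?_ fun b => ?_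
  · simp
  · intro x z h1 h2
    simp only [mul_add, map_add, ContinuousMap.add_apply, h1, h2, Finset.sum_add_distrib]
  have hf := hx a
  generalize fcoeff α a x = f at hf
  generalize fcoeff α b x' = g
  simp only [monom_mul_monom, fcoeff_monom]
  by_cases hij : (i : ℤ) - j = a + b
  · rw [if_pos hij]
    by_cases ht : 0 ≤ i - a ∧ i - a < N
    · have hc : ((⟨(i - a).toNat, by omega⟩ : Fin N) : ℤ) = i - a := Int.toNat_of_nonneg ht.1
      rw [Finset.sum_eq_single (⟨(i - a).toNat, by omega⟩ : Fin N)]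
      · rw [hc, if_pos (by omega), if_pos (by omega), map_mul, ContinuousMap.mul_apply,
          ← StarAlgEquiv.mul_apply, ← zpow_add, neg_sub, neg_add_eq_sub]
      · intro t _ ht'
        rw [if_neg (c := (i : ℤ) - t = a), map_zero, ContinuousMap.zero_apply, zero_mul]
        intro h'
        exact ht' (Fin.ext (by simp only; omega))
      · exact fun h' => absurd (Finset.mem_univ _) h'
    · rw [map_mul, ContinuousMap.mul_apply, hα.zpow_neg_apply_eq_zero hf, zero_mul]
      · refine (Finset.sum_eq_zero fun t _ => ?_).symm
        rw [if_neg (c := (i : ℤ) - t = a), map_zero, ContinuousMap.zero_apply, zero_mul]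
        omega
      · by_cases h0 : 0 ≤ (i : ℤ) - a
        · exact ⟨N, hN, by omega⟩
        · exact ⟨0, by rwa [zpow_zero], by omega⟩
  · rw [if_neg hij, map_zero, ContinuousMap.zero_apply]
    refine (Finset.sum_eq_zero fun t _ => ?_).symm
    by_cases h1 : (i : ℤ) - t = a
    · rw [if_neg (c := (t : ℤ) - j = b), map_zero, ContinuousMap.zero_apply, mul_zero]
      omega
    · rw [if_neg h1, map_zero, ContinuousMap.zero_apply, zero_mul]

lemma fcoeff_star (m : ℤ) (x : SkewLaurent α) :
    fcoeff α m (star x) = (α ^ m) (star (fcoeff α (-m) x)) :=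
  RegularModule.coeff_star α x (ZAct.of α m)

/-- The matrix of an element of `A[ℤ]` over a point of a tower base. -/
def towerMatrix (B : Set X) (N : ℕ) : SkewLaurent α →ₗ[ℂ] MatFun B N D where
  toFun x := ⟨fun y => Matrix.of fun i j : Fin N => (α ^ (-(i : ℤ))) (fcoeff α (i - j) x) y,
    continuous_matrix fun i j =>
      ((α ^ (-(i : ℤ))) (fcoeff α (i - j) x)).continuous.comp continuous_subtype_val⟩
  map_add' x y := by
    ext z i j
    simp
  map_smul' c x := by
    ext z i j
    simp [fcoeff_smul]

lemma towerMatrix_apply (B : Set X) (N : ℕ) (x : SkewLaurent α) (y : B) (i j : Fin N) :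
    towerMatrix B N x y i j = (α ^ (-(i : ℤ))) (fcoeff α (i - j) x) y := rfl

lemma towerMatrix_one (B : Set X) (N : ℕ) : towerMatrix (α := α) B N 1 = 1 := by
  ext y i j
  rw [towerMatrix_apply, ← monom_zero_one, fcoeff_monom, ContinuousMap.one_apply, Matrix.one_apply]
  by_cases hij : i = j
  · subst hij; simp
  · rw [if_neg hij, if_neg, map_zero, ContinuousMap.zero_apply]
    intro h'
    exact hij (Fin.ext (by omega))

/-- The components of the tower map. -/
def towerHom (T : IsTowerSystem h Y n) (hα : LiesOver α h) (k : Fin (l + 1)) :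
    breakingSkew Y hα →⋆ₐ[ℂ] MatFun (towerBase h Y (n k)) (n k) D where
  toFun x := towerMatrix _ _ x.1
  map_one' := towerMatrix_one _ _
  map_mul' x x' := by
    ext y i j
    rw [ContinuousMap.mul_apply, Matrix.mul_apply]
    exact sum_entries_mul hα x.2 (T.mem_of_mem_towerBase y.2)
      (T.zpow_mem_of_mem_towerBase y.2) i j
  map_zero' := map_zero (towerMatrix _ _)
  map_add' x x' := map_add (towerMatrix _ _) x.1 x'.1
  commutes' c := by
    rw [Algebra.algebraMap_eq_smul_one, Algebra.algebraMap_eq_smul_one]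
    exact (map_smul (towerMatrix _ _) c (1 : SkewLaurent α)).trans
      (congrArg (c • ·) (towerMatrix_one _ _))
  map_star' x := by
    ext y i j
    rw [ContinuousMap.star_apply, Matrix.star_apply, towerMatrix_apply, towerMatrix_apply]
    change (α ^ (-(i : ℤ))) (fcoeff α (i - j) (star x.1)) y = _
    rw [fcoeff_star, ← StarAlgEquiv.mul_apply, ← zpow_add, ← ContinuousMap.star_apply,
      ← map_star (α ^ (-(j : ℤ))), neg_sub, neg_add_eq_sub, sub_sub_cancel_left]

/-- The tower map `γ`. -/
def towerMap (T : IsTowerSystem h Y n) (hα : LiesOver α h) :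
    orbitBreaking α Y →⋆ₐ[ℂ] ∀ k, MatFun (towerBase h Y (n k)) (n k) D :=
  StarAlgHom.comp
    { toFun := fun x k => towerHom T hα k x
      map_one' := funext fun k => map_one (towerHom T hα k)
      map_mul' := fun x y => funext fun k => map_mul (towerHom T hα k) x y
      map_zero' := funext fun k => map_zero (towerHom T hα k)
      map_add' := fun x y => funext fun k => map_add (towerHom T hα k) x y
      commutes' := fun c => funext fun k => AlgHomClass.commutes (towerHom T hα k) c
      map_star' := fun x => funext fun k => map_star (towerHom T hα k) x }
    ((breakingEquiv hα T.exists_visit).symm : orbitBreaking α Y →⋆ₐ[ℂ] breakingSkew Y hα)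

/-! ### Existence and uniqueness of the tower map -/

open CrossedProduct

lemma towerMap_ofSkew (T : IsTowerSystem h Y n) (hα : LiesOver α h) {x : SkewLaurent α}
    (hx : x ∈ breakingSkew Y hα) (ha : ofSkew α x ∈ orbitBreaking α Y) (k : Fin (l + 1)) :
    towerMap T hα ⟨ofSkew α x, ha⟩ k = towerMatrix _ _ x := by
  have : (⟨ofSkew α x, ha⟩ : orbitBreaking α Y) = breakingEquiv hα T.exists_visit ⟨x, hx⟩ := rfl
  change towerHom T hα k ((breakingEquiv hα T.exists_visit).symm _) = _
  rw [this, StarAlgEquiv.symm_apply_apply]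
  rfl

lemma star_u_pow_mul_incl (m : ℕ) (f : C(X, D)) :
    star (u α) ^ m * incl α f = star (incl α (star f) * u α ^ m) := by
  have : star (incl α (star f)) = incl α f := by
    rw [incl_eq, ← map_star, star_monom, star_star, neg_zero, zpow_zero]; rfl
  rw [star_mul, this, star_pow]

lemma isTowerMap_towerMap (T : IsTowerSystem h Y n) (hα : LiesOver α h) :
    IsTowerMap h α Y n (towerMap T hα) := by
  have pos : ∀ (k : Fin (l + 1)) (m : ℕ), m < n k → ∀ f : C(X, D),
      (∀ x ∈ levelUnion h Y m, f x = 0) → ∃ ha : incl α f * u α ^ m ∈ orbitBreaking α Y,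
        towerMap T hα ⟨_, ha⟩ k = towerDiag α _ (n k) f * shift _ (n k) D ^ m := by
    intro k m hm f hf
    have hf' : ∀ z, Separated h Y z 0 (-m) → f z = 0 := fun z hz => hf z (mem_levelUnion_iff.2 hz)
    have hx := (monom_mem_breakingSkew (hα := hα)).2 hf'
    have ha : incl α f * u α ^ m ∈ orbitBreaking α Y := by
      rw [incl_mul_u_pow]
      exact ofSkew_mem_orbitBreaking hα T.exists_visit hx
    refine ⟨ha, ?_⟩
    have : (⟨_, ha⟩ : orbitBreaking α Y) = ⟨_, ofSkew_mem_orbitBreaking hα T.exists_visit hx⟩ :=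
      Subtype.ext (incl_mul_u_pow α f m)
    rw [this, towerMap_ofSkew T hα hx]
    ext y i j
    rw [towerMatrix_apply, fcoeff_monom, ContinuousMap.mul_apply]
    change _ = (Matrix.diagonal (fun i : Fin (n k) => (α ^ (-((i : ℕ) : ℤ))) f y) *
      (shift (towerBase h Y (n k)) (n k) D ^ m) y) i j
    rw [Matrix.diagonal_mul, shift_pow_apply _ _ _ (by omega)]
    by_cases hij : (i : ℤ) - j = m
    · rw [if_pos hij, if_pos, mul_one]
      rw [Nat.mod_eq_of_lt (by omega)]
      omega
    · rw [if_neg hij, map_zero, ContinuousMap.zero_apply]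
      -- The entries in the wrapped-around corner of `sᵐ` have `i - m < 0 ≤ i`; there the visit at
      -- time `0` makes the coefficient vanish.
      split_ifs with h1
      · rw [mul_one, hα.zpow_neg_apply_eq_zero hf' ⟨0, ?_, ?_⟩]
        · rw [zpow_zero]
          exact T.mem_of_mem_towerBase y.2
        · rcases lt_or_ge (j + m : ℕ) (n k) with h2 | h2
          · rw [Nat.mod_eq_of_lt h2] at h1
            omega
          · rw [Nat.mod_eq_sub_mod h2, Nat.mod_eq_of_lt (by omega)] at h1
            omega
      · rw [mul_zero]
  refine ⟨pos, fun k m hm f hf => ?_⟩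
  obtain ⟨ha, hγ⟩ := pos k m hm (star f) fun x hx => by
    rw [ContinuousMap.star_apply, hf x hx, star_zero]
  have ha' : star (u α) ^ m * incl α f ∈ orbitBreaking α Y := by
    rw [star_u_pow_mul_incl]
    exact star_mem ha
  refine ⟨ha', ?_⟩
  have : (⟨_, ha'⟩ : orbitBreaking α Y) = star ⟨_, ha⟩ := Subtype.ext (star_u_pow_mul_incl m f)
  rw [this, map_star, Pi.star_apply, hγ, star_mul, star_pow, star_towerDiag, star_star]

/-- The defining equations say nothing about degrees `m ≥ n(k)`. There, with `a = f uᵐ`, the element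
`a a* = f f*` has degree `0`. Its image is diagonal with zero entries, as the visit at time `0`
separates `i` from `i - m < 0`. -/
lemma IsTowerMap.apply_monom_nat (T : IsTowerSystem h Y n) {γ : orbitBreaking α Y →⋆ₐ[ℂ]
    ∀ k, MatFun (towerBase h Y (n k)) (n k) D} (hγ : IsTowerMap h α Y n γ) (hα : LiesOver α h)
    (m : ℕ) (f : C(X, D)) (hf : ∀ z, Separated h Y z 0 (-m) → f z = 0) (k : Fin (l + 1))
    (ha : incl α f * u α ^ m ∈ orbitBreaking α Y) :
    γ ⟨_, ha⟩ k = if m < n k then towerDiag α _ (n k) f * shift _ (n k) D ^ m else 0 := by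
  split_ifs with hm
  · obtain ⟨_, h2⟩ := hγ.pos k m hm f fun x hx => hf x (mem_levelUnion_iff.1 hx)
    exact h2
  · refine eq_zero_of_mul_star_self_eq_zero ?_
    obtain ⟨hb, h2⟩ := hγ.pos k 0 (T.one_le_size k) (f * star f) fun x hx =>
      absurd (mem_levelUnion_iff.1 hx) (by simpa using not_separated_self x 0)
    rw [← Pi.star_apply, ← map_star, ← Pi.mul_apply, ← map_mul]
    have h3 : (⟨_, ha⟩ : orbitBreaking α Y) * star ⟨_, ha⟩ = ⟨_, hb⟩ := by
      refine Subtype.ext ?_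
      change incl α f * u α ^ m * star (incl α f * u α ^ m) = incl α (f * star f) * u α ^ 0
      rw [incl_mul_u_pow, incl_mul_u_pow, ← map_star, ← map_mul, star_monom, monom_mul_monom,
        ← StarAlgEquiv.mul_apply, ← zpow_add]
      simp
    rw [h3, h2, pow_zero, mul_one]
    ext y i j
    change Matrix.diagonal (fun i : Fin (n k) => (α ^ (-((i : ℕ) : ℤ))) (f * star f) y) i j = 0
    rw [Matrix.diagonal_apply]
    split_ifs
    · rw [map_mul, ContinuousMap.mul_apply, hα.zpow_neg_apply_eq_zero hf, zero_mul]
      refine ⟨0, ?_, by omega⟩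
      rw [zpow_zero]
      exact T.mem_of_mem_towerBase y.2
    · rfl

/-- No density argument is needed: `A_Y` consists of finite sums of monomials lying in it, and those
of negative degree are adjoints of those of positive degree. -/
lemma IsTowerMap.unique (T : IsTowerSystem h Y n) (hα : LiesOver α h) {γ γ' : orbitBreaking α Y
    →⋆ₐ[ℂ] ∀ k, MatFun (towerBase h Y (n k)) (n k) D} (hγ : IsTowerMap h α Y n γ)
    (hγ' : IsTowerMap h α Y n γ') : γ = γ' := by
  refine StarAlgHom.ext fun a => ?_
  obtain ⟨⟨x, hx⟩, rfl⟩ := (breakingEquiv hα T.exists_visit).surjective a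
  set E := (StarAlgHom.equalizer γ γ').map (orbitBreaking α Y).subtype with hE
  suffices hmem : ofSkew α x ∈ E by
    obtain ⟨a, ha, hax⟩ := hmem
    have : a = breakingEquiv hα T.exists_visit ⟨x, hx⟩ := Subtype.ext hax
    exact this ▸ ha
  have nat : ∀ (m : ℕ) (f : C(X, D)), monom α m f ∈ breakingSkew Y hα →
      ofSkew α (monom α m f) ∈ E := by
    intro m f hf
    have ha := ofSkew_mem_orbitBreaking hα T.exists_visit hf
    rw [← incl_mul_u_pow] at ha ⊢
    refine ⟨⟨_, ha⟩, funext fun k => ?_, rfl⟩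
    rw [monom_mem_breakingSkew] at hf
    exact (hγ.apply_monom_nat T hα m f hf k ha).trans (hγ'.apply_monom_nat T hα m f hf k ha).symm
  refine SkewLaurent.induction_terms (P := fun x => ofSkew α x ∈ E) x ?_ ?_ fun m => ?_
  · rw [map_zero]; exact zero_mem _
  · intro x y h1 h2
    rw [map_add]; exact add_mem h1 h2
  have h1 := monom_mem_breakingSkew (hα := hα).2 (hx m)
  obtain ⟨k, rfl | rfl⟩ := m.eq_nat_or_neg
  · exact nat k _ h1
  · rw [← star_star (monom α _ _), map_star]
    refine star_mem ?_
    have h2 := star_mem h1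
    rw [star_monom, neg_neg] at h2 ⊢
    exact nat k _ h2

end TowerHom

/-! ### Families of matrix valued functions on the tower bases -/

section Symbols

variable {X : Type u} [TopologicalSpace X] {D : Type v} [CStarAlgebra D]
  {α : C(X, D) ≃⋆ₐ[ℂ] C(X, D)} {h : X ≃ₜ X} {Y : Set X} {l : ℕ} {n : Fin (l + 1) → ℕ}
  {k : Fin (l + 1)}

variable (D h Y n k) in
/-- `⨁_{j ≤ k} C(Y_j, M_{n(j)}(D))`. -/
abbrev TowerFamily : Type (max u v) :=
  ∀ j : Set.Iic k, MatFun (towerBase h Y (n j)) (n j) D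

/-- The entry in position `(p, q)` of the `j`-th member of a family at `y`, extended by zero. -/
def entryExt (b : TowerFamily D h Y n k) (j : Fin (l + 1)) (y : X) (p q : ℤ) : D :=
  open Classical in
  if H : (j ≤ k ∧ y ∈ towerBase h Y (n j)) ∧ (0 ≤ p ∧ p < n j) ∧ 0 ≤ q ∧ q < n j then
    b ⟨j, H.1.1⟩ ⟨y, H.1.2⟩ ⟨p.toNat, (Int.toNat_lt H.2.1.1).2 H.2.1.2⟩
      ⟨q.toNat, (Int.toNat_lt H.2.2.1).2 H.2.2.2⟩
  else 0

lemma entryExt_coe (b : TowerFamily D h Y n k) (j : Set.Iic k) (y : towerBase h Y (n j))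
    (p q : Fin (n j)) : entryExt b j y p q = b j y p q := by
  rw [entryExt, dif_pos ⟨⟨j.2, y.2⟩, by omega, by omega⟩]
  simp

lemma entryExt_eq_zero (b : TowerFamily D h Y n k) (j : Fin (l + 1)) (y : X) {p q : ℤ}
    (hpq : ¬ ((0 ≤ p ∧ p < n j) ∧ 0 ≤ q ∧ q < n j)) : entryExt b j y p q = 0 := by
  rw [entryExt, dif_neg fun H => hpq H.2]

lemma entryExt_zero (j : Fin (l + 1)) (y : X) (p q : ℤ) :
    entryExt (0 : TowerFamily D h Y n k) j y p q = 0 := by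
  unfold entryExt
  split_ifs <;> rfl

lemma entryExt_add (b b' : TowerFamily D h Y n k) (j : Fin (l + 1)) (y : X) (p q : ℤ) :
    entryExt (b + b') j y p q = entryExt b j y p q + entryExt b' j y p q := by
  unfold entryExt
  split_ifs
  · rfl
  · rw [add_zero]

lemma entryExt_smul (c : ℂ) (b : TowerFamily D h Y n k) (j : Fin (l + 1)) (y : X) (p q : ℤ) :
    entryExt (c • b) j y p q = c • entryExt b j y p q := by
  unfold entryExt
  split_ifs
  · rfl
  · rw [smul_zero]

lemma entryExt_star (b : TowerFamily D h Y n k) (j : Fin (l + 1)) (y : X) (p q : ℤ) :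
    entryExt (star b) j y p q = star (entryExt b j y q p) := by
  unfold entryExt
  by_cases H : (j ≤ k ∧ y ∈ towerBase h Y (n j)) ∧ (0 ≤ p ∧ p < n j) ∧ 0 ≤ q ∧ q < n j
  · rw [dif_pos H, dif_pos ⟨H.1, H.2.2, H.2.1⟩]
    rfl
  · rw [dif_neg H, dif_neg fun H' => H ⟨H'.1, H'.2.2, H'.2.1⟩, star_zero]

lemma entryExt_one {j : Fin (l + 1)} (hj : j ≤ k) {y : X} (hy : y ∈ towerBase h Y (n j)) {p q : ℤ}
    (hp : 0 ≤ p ∧ p < n j) :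
    entryExt (1 : TowerFamily D h Y n k) j y p q = if p = q then 1 else 0 := by
  by_cases hq : 0 ≤ q ∧ q < n j
  · rw [entryExt, dif_pos ⟨⟨hj, hy⟩, hp, hq⟩, Pi.one_apply, ContinuousMap.one_apply,
      Matrix.one_apply]
    exact if_congr (by rw [Fin.ext_iff]; simp only; omega) rfl rfl
  · rw [entryExt_eq_zero _ _ _ fun H => hq H.2, if_neg]
    rintro rfl
    exact hq hp

lemma sum_fin_eq_sum_Ico {M : Type*} [AddCommMonoid M] (N : ℕ) (f : ℤ → M) :
    ∑ i : Fin N, f i = ∑ t ∈ Finset.Ico (0 : ℤ) N, f t := by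
  refine Finset.sum_bij (fun i _ => (i : ℤ)) (fun i _ => Finset.mem_Ico.2 (by omega))
    (fun i _ j _ hij => Fin.ext (by omega)) (fun t ht => ?_) fun _ _ => rfl
  rw [Finset.mem_Ico] at ht
  exact ⟨⟨t.toNat, by omega⟩, Finset.mem_univ _, Int.toNat_of_nonneg ht.1⟩

/-- Extension by zero lets the summation range be any interval containing `[0, n(j))`, as is needed
when a block is placed inside a longer orbit segment. -/
lemma entryExt_mul (b b' : TowerFamily D h Y n k) (j : Fin (l + 1)) (y : X) (p q : ℤ) {a c : ℤ}
    (ha : a ≤ 0) (hc : n j ≤ c) : entryExt (b * b') j y p q =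
      ∑ t ∈ Finset.Ico a c, entryExt b j y p t * entryExt b' j y t q := by
  have h1 : ∑ t ∈ Finset.Ico a c, entryExt b j y p t * entryExt b' j y t q =
      ∑ t ∈ Finset.Ico (0 : ℤ) (n j), entryExt b j y p t * entryExt b' j y t q := by
    refine (Finset.sum_subset (Finset.Ico_subset_Ico ha hc) fun t _ ht => ?_).symm
    rw [Finset.mem_Ico] at ht
    rw [entryExt_eq_zero _ _ _ fun H => ht H.2, zero_mul]
  rw [h1, ← sum_fin_eq_sum_Ico]
  by_cases H : (j ≤ k ∧ y ∈ towerBase h Y (n j)) ∧ (0 ≤ p ∧ p < n j) ∧ 0 ≤ q ∧ q < n j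
  · rw [entryExt, dif_pos H, Pi.mul_apply, ContinuousMap.mul_apply, Matrix.mul_apply]
    refine Finset.sum_congr rfl fun t _ => ?_
    have ht : 0 ≤ (t : ℤ) ∧ (t : ℤ) < n j := ⟨Int.natCast_nonneg _, Int.ofNat_lt.2 t.2⟩
    rw [entryExt, dif_pos ⟨H.1, H.2.1, ht⟩, entryExt, dif_pos ⟨H.1, ht, H.2.2⟩]
    simp
  · rw [entryExt, dif_neg H]
    refine (Finset.sum_eq_zero fun t _ => ?_).symm
    by_cases H1 : (j ≤ k ∧ y ∈ towerBase h Y (n j)) ∧ 0 ≤ p ∧ p < n j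
    · rw [entryExt.eq_1 b' j, dif_neg fun H2 => H ⟨H1.1, H1.2, H2.2.2⟩, mul_zero]
    · rw [entryExt.eq_1 b j, dif_neg fun H2 => H1 ⟨H2.1, H2.2.1⟩, zero_mul]

lemma continuous_entryExt (b : TowerFamily D h Y n k) {j : Fin (l + 1)} (p q : ℤ) {Z : Type*}
    [TopologicalSpace Z] {φ : Z → X} (hφ : Continuous φ) (hmem : ∀ z, φ z ∈ towerBase h Y (n j)) :
    Continuous fun z => entryExt b j (φ z) p q := by
  by_cases H : j ≤ k ∧ (0 ≤ p ∧ p < n j) ∧ 0 ≤ q ∧ q < n j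
  · have h1 : (fun z => entryExt b j (φ z) p q) = fun z => b ⟨j, H.1⟩ ⟨φ z, hmem z⟩
        ⟨p.toNat, (Int.toNat_lt H.2.1.1).2 H.2.1.2⟩
        ⟨q.toNat, (Int.toNat_lt H.2.2.1).2 H.2.2.2⟩ := by
      funext z
      rw [entryExt, dif_pos ⟨⟨H.1, hmem z⟩, H.2⟩]
    rw [h1]
    exact ((b ⟨j, H.1⟩).continuous.comp (hφ.subtype_mk hmem)).matrix_elem _ _
  · have h1 : (fun z => entryExt b j (φ z) p q) = fun _ => 0 := by
      funext z
      rw [entryExt, dif_neg fun H' => H ⟨H'.1.1, H'.2⟩]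
    rw [h1]
    exact continuous_const

/-! ### Symbols and the matrices over orbit segments -/

variable (α) in
/-- The coefficient of `uᵐ` at `z` of the element of the orbit breaking subalgebra that corresponds
to a family of matrix valued functions. -/
def symbol (b : TowerFamily D h Y n k) (m : ℤ) (z : X) : D :=
  fiberHom α (lastVisit h Y z) z (entryExt b (towerIndex h Y n ((h ^ lastVisit h Y z) z))
    ((h ^ lastVisit h Y z) z) (-lastVisit h Y z) (-lastVisit h Y z - m))

variable (α) in
/-- The matrix over an orbit segment starting at `x` that is determined by the symbol. -/
def orbitMatrix (b : TowerFamily D h Y n k) (x : X) (N : ℕ) : Matrix (Fin N) (Fin N) D :=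
  Matrix.of fun i j => fiberHom α i x (symbol α b (i - j) ((h ^ (i : ℤ)) x))

lemma orbitMatrix_apply (b : TowerFamily D h Y n k) (x : X) (N : ℕ) (i j : Fin N) :
    orbitMatrix α b x N i j = fiberHom α i x (symbol α b (i - j) ((h ^ (i : ℤ)) x)) := rfl

/-- If the block containing position `p` starts at `s`, row `p` of the orbit matrix is a row of the
member of `b` over `h^s(x)`, with positions counted from `s` and transported to the fibre at `x`. -/
lemma LiesOver.fiberHom_symbol (hα : LiesOver α h) (b : TowerFamily D h Y n k) (x : X) {s p : ℤ}
    (q : ℤ) (hs : lastVisit h Y ((h ^ p) x) = s - p) :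
    fiberHom α p x (symbol α b (p - q) ((h ^ p) x)) =
      fiberHom α s x (entryExt b (towerIndex h Y n ((h ^ s) x)) ((h ^ s) x) (p - s) (q - s)) := by
  rw [symbol, hs, hα.fiberHom_fiberHom, ← zpow_add_apply, sub_add_cancel, add_sub_cancel, neg_sub]
  congr 2
  ring

variable (h Y n k) in
/-- The orbit segment of length `N` starting at `x` begins and ends in `Y`, and on the way the return
times have index at most `k`. -/
structure IsOrbitSegment (x : X) (N : ℕ) : Prop where
  mem : x ∈ Y
  zpow_mem : (h ^ (N : ℤ)) x ∈ Y
  index_le : ∀ s : ℤ, 0 ≤ s → s < N → (h ^ s) x ∈ Y → towerIndex h Y n ((h ^ s) x) ≤ k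

namespace IsTowerSystem

variable (T : IsTowerSystem h Y n)
include T

/-- Position `-m` lies outside the block of position `0`, so the symbol refers to a column beyond
the matrix, where the entry is zero. -/
lemma symbol_eq_zero (b : TowerFamily D h Y n k) {m : ℤ} {z : X}
    (hz : Separated h Y z 0 (-m)) : symbol α b m z = 0 := by
  obtain ⟨s, h1, h2, h3, h4, h5, h6⟩ := T.exists_block z 0
  obtain ⟨t, ht, hn⟩ := hz
  have hs := h6 0 h1 h3
  rw [zpow_zero, sub_zero] at hs
  change lastVisit h Y z = s at hs
  rw [symbol, hs, entryExt_eq_zero, map_zero]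
  have := h5 t ht
  omega

/-- The part of the segment that lies between two successive visits to `Y`. -/
lemma exists_segment_block {x : X} {N : ℕ} (S : IsOrbitSegment h Y n k x N) (i : Fin N) :
    ∃ s : ℤ, 0 ≤ s ∧ s ≤ i ∧ (h ^ s) x ∈ Y ∧ i < s + n (towerIndex h Y n ((h ^ s) x)) ∧
      (h ^ (s + n (towerIndex h Y n ((h ^ s) x)))) x ∈ Y ∧
      s + n (towerIndex h Y n ((h ^ s) x)) ≤ N ∧ towerIndex h Y n ((h ^ s) x) ≤ k ∧
      ∀ q, s ≤ q → q < s + n (towerIndex h Y n ((h ^ s) x)) →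
        lastVisit h Y ((h ^ q) x) = s - q := by
  obtain ⟨s, h1, h2, h3, h4, h5, h6⟩ := T.exists_block x i
  have h7 := h5 0 (by rw [zpow_zero]; exact S.mem)
  have h8 := h5 N S.zpow_mem
  have := i.2
  exact ⟨s, by omega, h1, h2, h3, h4, by omega, S.index_le s (by omega) (by omega) h2, h6⟩

lemma orbitMatrix_one (hα : LiesOver α h) {x : X} {N : ℕ} (S : IsOrbitSegment h Y n k x N) :
    orbitMatrix α (1 : TowerFamily D h Y n k) x N = 1 := by
  ext i j
  obtain ⟨s, h0, h1, h2, h3, h4, h5, h6, h7⟩ := T.exists_segment_block S i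
  rw [orbitMatrix_apply, hα.fiberHom_symbol _ _ _ (h7 i h1 h3),
    entryExt_one h6 (T.mem_towerBase_index h2) (by omega), Matrix.one_apply]
  by_cases hij : i = j
  · rw [if_pos (by rw [hij]), if_pos hij, map_one]
  · rw [if_neg (fun h' => hij (Fin.ext (by omega))), if_neg hij, map_zero]

/-- The block containing row `i` lies inside the segment, and entries with columns outside it
vanish. So the product is computed within that block, by a single member of the families. -/
lemma orbitMatrix_mul (hα : LiesOver α h) {x : X} {N : ℕ} (S : IsOrbitSegment h Y n k x N)
    (b b' : TowerFamily D h Y n k) :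
    orbitMatrix α (b * b') x N = orbitMatrix α b x N * orbitMatrix α b' x N := by
  ext i j
  obtain ⟨s, h0, h1, h2, h3, h4, h5, h6, h7⟩ := T.exists_segment_block S i
  have hi := h7 i h1 h3
  rw [Matrix.mul_apply, orbitMatrix_apply, hα.fiberHom_symbol _ _ _ hi,
    entryExt_mul b b' _ _ _ _ (a := 0 + -s) (c := N + -s) (by omega) (by omega), map_sum,
    ← Finset.sum_Ico_add', ← sum_fin_eq_sum_Ico]
  refine Finset.sum_congr rfl fun t _ => ?_
  rw [map_mul, orbitMatrix_apply, hα.fiberHom_symbol _ _ _ hi, ← sub_eq_add_neg]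
  by_cases ht : s ≤ t ∧ t < s + n (towerIndex h Y n ((h ^ s) x))
  · rw [orbitMatrix_apply, hα.fiberHom_symbol _ _ _ (h7 t ht.1 ht.2)]
  · rw [entryExt_eq_zero _ _ _ (by omega), map_zero, zero_mul, zero_mul]

lemma orbitMatrix_star (hα : LiesOver α h) {x : X} {N : ℕ} (S : IsOrbitSegment h Y n k x N)
    (b : TowerFamily D h Y n k) :
    orbitMatrix α (star b) x N = star (orbitMatrix α b x N) := by
  ext i j
  obtain ⟨s, h0, h1, h2, h3, h4, h5, h6, h7⟩ := T.exists_segment_block S i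
  rw [Matrix.star_apply, orbitMatrix_apply, hα.fiberHom_symbol _ _ _ (h7 i h1 h3), entryExt_star,
    orbitMatrix_apply]
  by_cases hj : s ≤ j ∧ j < s + n (towerIndex h Y n ((h ^ s) x))
  · rw [hα.fiberHom_symbol _ _ _ (h7 j hj.1 hj.2), map_star]
  · rw [entryExt_eq_zero _ _ _ (by omega), T.symbol_eq_zero]
    · simp
    · rw [separated_zpow_apply, zero_add, neg_sub, sub_add_cancel]
      by_cases hjs : s ≤ j
      · exact ⟨_, h4, by omega⟩
      · exact ⟨_, h2, by omega⟩

end IsTowerSystem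

/-- The *-homomorphism given by the matrices over an orbit segment. -/
def orbitHom (T : IsTowerSystem h Y n) (hα : LiesOver α h) {x : X} {N : ℕ}
    (S : IsOrbitSegment h Y n k x N) : TowerFamily D h Y n k →⋆ₐ[ℂ] Matrix (Fin N) (Fin N) D where
  toFun b := orbitMatrix α b x N
  map_one' := T.orbitMatrix_one hα S
  map_mul' := T.orbitMatrix_mul hα S
  map_zero' := by
    ext i j
    simp [orbitMatrix_apply, symbol, entryExt_zero]
  map_add' b b' := by
    ext i j
    simp [orbitMatrix_apply, symbol, entryExt_add]
  commutes' c := by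
    rw [Algebra.algebraMap_eq_smul_one, Algebra.algebraMap_eq_smul_one,
      ← T.orbitMatrix_one hα S]
    ext i j
    simp [orbitMatrix_apply, symbol, entryExt_smul]
  map_star' := T.orbitMatrix_star hα S

/-! ### The stage algebras -/

variable (D h Y n k) in
/-- Evaluation of the `j`-th member of a family at a point. -/
def evalFamily (j : Set.Iic k) (y : towerBase h Y (n j)) :
    TowerFamily D h Y n k →⋆ₐ[ℂ] Matrix (Fin (n j)) (Fin (n j)) D where
  toFun b := b j y
  map_one' := rfl
  map_mul' _ _ := rfl
  map_zero' := rfl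
  map_add' _ _ := rfl
  commutes' _ := rfl
  map_star' _ := rfl

lemma IsTowerSystem.isOrbitSegment (T : IsTowerSystem h Y n) {j : Fin (l + 1)} (hj : j ≤ k) {y : X}
    (hy : y ∈ towerBase h Y (n j)) : IsOrbitSegment h Y n k y (n j) where
  mem := T.mem_of_mem_towerBase hy
  zpow_mem := T.zpow_mem_of_mem_towerBase hy
  index_le s hs0 hsn hs := by
    refine le_trans ?_ hj
    rw [← T.strictMono.le_iff_le, T.size_index hs]
    have h1 : (h ^ ((n j : ℤ) - s)) ((h ^ s) y) ∈ Y := by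
      rw [← zpow_add_apply, sub_add_cancel]
      exact T.zpow_mem_of_mem_towerBase hy
    have := returnTime_le (by omega) h1
    omega

/-- A visit at a time `s > 0` is followed by the one at `n(k+1)`, so its return time is less than
`n(k+1)`. At time `0` the strict drop of the index comes from membership in an earlier base. -/
lemma IsTowerSystem.isOrbitSegment_succ (T : IsTowerSystem h Y n) {k : Fin l} {x : X}
    (hx : x ∈ towerBase h Y (n k.succ)) (hx' : ∃ j < k.succ, x ∈ towerBase h Y (n j)) :
    IsOrbitSegment h Y n k.castSucc x (n k.succ) where
  mem := T.mem_of_mem_towerBase hx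
  zpow_mem := T.zpow_mem_of_mem_towerBase hx
  index_le s hs0 hsn hs := by
    rw [Fin.le_castSucc_iff]
    rcases hs0.eq_or_lt with rfl | hpos
    · obtain ⟨j, hj, hxj⟩ := hx'
      rw [zpow_zero]
      exact (T.index_le_of_mem_towerBase hxj).trans_lt hj
    · rw [← T.strictMono.lt_iff_lt, T.size_index hs]
      have h1 : (h ^ ((n k.succ : ℤ) - s)) ((h ^ s) x) ∈ Y := by
        rw [← zpow_add_apply, sub_add_cancel]
        exact T.zpow_mem_of_mem_towerBase hx
      have := returnTime_le (by omega) h1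
      omega

/-- The `k`-th stage algebra: the families that are compatible with their symbol. -/
def stageAlgebra (T : IsTowerSystem h Y n) (hα : LiesOver α h) (k : Fin (l + 1)) :
    StarSubalgebra ℂ (TowerFamily D h Y n k) :=
  ⨅ (j : Set.Iic k) (y : towerBase h Y (n j)), StarAlgHom.equalizer (evalFamily D h Y n k j y)
    (orbitHom T hα (T.isOrbitSegment j.2 y.2))

lemma mem_stageAlgebra (T : IsTowerSystem h Y n) (hα : LiesOver α h)
    {b : TowerFamily D h Y n k} : b ∈ stageAlgebra T hα k ↔
      ∀ (j : Set.Iic k) (y : towerBase h Y (n j)), b j y = orbitMatrix α b y (n j) := by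
  simp only [stageAlgebra, StarSubalgebra.mem_iInf, StarAlgHom.mem_equalizer]
  rfl

/-- The compatibility is automatic at points that return to `Y` as late as possible. -/
lemma eq_orbitMatrix_of_index_eq (T : IsTowerSystem h Y n) (hα : LiesOver α h)
    (b : TowerFamily D h Y n k) (j : Set.Iic k) (y : towerBase h Y (n j))
    (hy : towerIndex h Y n (y : X) = j) : b j y = orbitMatrix α b y (n j) := by
  ext p q
  obtain ⟨s, h1, h2, h3, h4, h5, h6⟩ := T.exists_block (y : X) 0
  have h7 := h5 0 (by rw [zpow_zero]; exact T.mem_of_mem_towerBase y.2)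
  -- Time `0` is a visit, so the block containing it starts there; as its length is `n(j)`, it is
  -- the whole segment.
  obtain rfl : s = 0 := by omega
  rw [zpow_zero] at h6
  change ∀ q : ℤ, 0 ≤ q → q < 0 + n (towerIndex h Y n (y : X)) → _ at h6
  rw [hy] at h6
  rw [orbitMatrix_apply, hα.fiberHom_symbol _ _ _ (h6 p (by omega) (by omega)), fiberHom_zero,
    zpow_zero]
  change _ = entryExt b (towerIndex h Y n (y : X)) y _ _
  rw [hy, sub_zero, sub_zero, entryExt_coe]

end Symbols

/-! ### The recursive subhomogeneous decomposition -/

section Decomposition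

variable {X : Type u} [TopologicalSpace X] {D : Type v} [CStarAlgebra D]
  {α : C(X, D) ≃⋆ₐ[ℂ] C(X, D)} {h : X ≃ₜ X} {Y : Set X} {l : ℕ} {n : Fin (l + 1) → ℕ}
  {k : Fin (l + 1)}

variable (h Y n k) in
/-- The union of the towers over the bases `Y_j` with `j ≤ k`. -/
def towerRegion : Set X :=
  ⋃ i : (j : Set.Iic k) × Fin (n j), (h ^ (i.2 : ℤ)) '' towerBase h Y (n i.1)

lemma IsTowerSystem.zpow_mem_towerRegion (T : IsTowerSystem h Y n) {x : X} {N : ℕ}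
    (S : IsOrbitSegment h Y n k x N) (i : Fin N) : (h ^ (i : ℤ)) x ∈ towerRegion h Y n k := by
  obtain ⟨s, h0, h1, h2, h3, h4, h5, h6, h7⟩ := T.exists_segment_block S i
  refine Set.mem_iUnion.2 ⟨⟨⟨_, h6⟩, ⟨(i - s).toNat, ?_⟩⟩, (h ^ s) x, T.mem_towerBase_index h2, ?_⟩
  · change (i - s).toNat < n (towerIndex h Y n ((h ^ s) x))
    omega
  · simp only
    rw [← zpow_add_apply, Int.toNat_of_nonneg (by omega), sub_add_cancel]

lemma IsTowerSystem.towerRegion_last (T : IsTowerSystem h Y n) :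
    towerRegion h Y n (Fin.last l) = Set.univ := by
  refine Set.eq_univ_of_forall fun z => ?_
  obtain ⟨s, h1, h2, h3, -⟩ := T.exists_block z 0
  refine Set.mem_iUnion.2 ⟨⟨⟨_, Fin.le_last _⟩, ⟨(-s).toNat, ?_⟩⟩, (h ^ s) z,
    T.mem_towerBase_index h2, ?_⟩
  · change (-s).toNat < n (towerIndex h Y n ((h ^ s) z))
    omega
  · simp only
    rw [← zpow_add_apply, Int.toNat_of_nonneg (by omega), neg_add_cancel, zpow_zero]
    rfl

/-- For a compatible family the symbol may be read off from any tower through the point, including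
those over bases that do not correspond to the last visit. This makes the local formulas agree on
overlaps. -/
lemma symbol_zpow_apply (T : IsTowerSystem h Y n) (hα : LiesOver α h) {b : TowerFamily D h Y n k}
    (hb : b ∈ stageAlgebra T hα k) (j : Set.Iic k) (y : towerBase h Y (n j)) (p : Fin (n j)) (m : ℤ) :
    symbol α b m ((h ^ (p : ℤ)) y) =
      fiberHom α (-p) ((h ^ (p : ℤ)) (y : X)) (entryExt b j y p (p - m)) := by
  by_cases hq : 0 ≤ (p : ℤ) - m ∧ (p : ℤ) - m < n j
  · have hc : ((⟨((p : ℤ) - m).toNat, by omega⟩ : Fin (n j)) : ℤ) = p - m :=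
      Int.toNat_of_nonneg hq.1
    rw [← hc, entryExt_coe, (mem_stageAlgebra T hα).1 hb, orbitMatrix_apply,
      hα.fiberHom_neg_fiberHom, hc, sub_sub_cancel]
  · rw [entryExt_eq_zero _ _ _ fun H => hq H.2, map_zero, T.symbol_eq_zero]
    rw [separated_zpow_apply, zero_add, neg_add_eq_sub]
    exact separated_of_notMem (T.mem_of_mem_towerBase y.2) (T.zpow_mem_of_mem_towerBase y.2)
      (by omega) (by omega) hq

variable [CompactSpace X]

/-- On each of the finitely many closed sets `h^p(Y_j)` the symbol is given by one matrix entry of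
`b_j`, transported by a jointly continuous fibre map. -/
lemma continuousOn_symbol (T : IsTowerSystem h Y n) (hα : LiesOver α h) {b : TowerFamily D h Y n k}
    (hb : b ∈ stageAlgebra T hα k) (m : ℤ) : ContinuousOn (symbol α b m) (towerRegion h Y n k) := by
  refine (locallyFinite_of_finite _).continuousOn_iUnion
    (fun i => (h ^ (i.2 : ℤ)).isClosedMap _ (isClosed_towerBase _)) ?_
  rintro ⟨j, p⟩
  rw [continuousOn_iff_continuous_domRestrict]
  have hinv : ∀ y : X, (h ^ (-(p : ℤ))) ((h ^ (p : ℤ)) y) = y := fun y => by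
    rw [← zpow_add_apply, neg_add_cancel, zpow_zero]; rfl
  have h1 : Set.domRestrict ((h ^ (p : ℤ)) '' towerBase h Y (n j)) (symbol α b m) =
      fun z : ((h ^ (p : ℤ)) '' towerBase h Y (n j) : Set X) => fiberHom α (-p) (z : X)
        (entryExt b j ((h ^ (-(p : ℤ))) z) p (p - m)) := by
    funext ⟨_, y, hy, rfl⟩
    rw [Set.domRestrict_apply, symbol_zpow_apply T hα hb j ⟨y, hy⟩ p m, hinv]
  rw [h1]
  refine (continuous_fiberHom α (-p)).comp (continuous_subtype_val.prodMk
    (continuous_entryExt b _ _ ((h ^ (-(p : ℤ))).continuous.comp continuous_subtype_val) ?_))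
  rintro ⟨_, y, hy, rfl⟩
  rw [Function.comp_apply, hinv]
  exact hy

/-- The gluing map of stage `k + 1`. -/
def gluingMap (T : IsTowerSystem h Y n) (hα : LiesOver α h) (k : Fin l) :
    stageAlgebra T hα k.castSucc →⋆ₐ[ℂ] MatFun
      {x : towerBase h Y (n k.succ) | ∃ j < k.succ, (x : X) ∈ towerBase h Y (n j)} (n k.succ) D where
  toFun b := ⟨fun x => orbitHom T hα (T.isOrbitSegment_succ x.1.2 x.2) b.1,
    continuous_matrix fun i _ => (continuous_fiberHom α i).comp
      ((continuous_subtype_val.comp continuous_subtype_val).prodMk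
        ((continuousOn_symbol T hα b.2 _).comp_continuous
          ((h ^ (i : ℤ)).continuous.comp (continuous_subtype_val.comp continuous_subtype_val))
          fun x => T.zpow_mem_towerRegion (T.isOrbitSegment_succ x.1.2 x.2) i))⟩
  map_one' := ContinuousMap.ext fun x => map_one (orbitHom T hα (T.isOrbitSegment_succ x.1.2 x.2))
  map_mul' b b' := ContinuousMap.ext fun x =>
    map_mul (orbitHom T hα (T.isOrbitSegment_succ x.1.2 x.2)) b.1 b'.1
  map_zero' := ContinuousMap.ext fun x => map_zero (orbitHom T hα (T.isOrbitSegment_succ x.1.2 x.2))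
  map_add' b b' := ContinuousMap.ext fun x =>
    map_add (orbitHom T hα (T.isOrbitSegment_succ x.1.2 x.2)) b.1 b'.1
  commutes' c := ContinuousMap.ext fun x => AlgHomClass.commutes
    (orbitHom T hα (T.isOrbitSegment_succ x.1.2 x.2)) c
  map_star' b := ContinuousMap.ext fun x =>
    map_star (orbitHom T hα (T.isOrbitSegment_succ x.1.2 x.2)) b.1

lemma gluingMap_apply (T : IsTowerSystem h Y n) (hα : LiesOver α h) (k : Fin l)
    (b : stageAlgebra T hα k.castSucc)
    (x : {x : towerBase h Y (n k.succ) | ∃ j < k.succ, (x : X) ∈ towerBase h Y (n j)}) :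
    gluingMap T hα k b x = orbitMatrix α b.1 (x : towerBase h Y (n k.succ)) (n k.succ) := rfl

omit [CompactSpace X] in
lemma entryExt_truncate {k : Fin l} (b : TowerFamily D h Y n k.succ) {j : Fin (l + 1)}
    (hj : j ≤ k.castSucc) (y : X) (p q : ℤ) :
    entryExt (truncate (E := fun j => MatFun (towerBase h Y (n j)) (n j) D) k b :
      TowerFamily D h Y n k.castSucc) j y p q = entryExt b j y p q := by
  have hj' := hj.trans k.castSucc_le_succ
  by_cases H : y ∈ towerBase h Y (n j) ∧ (0 ≤ p ∧ p < n j) ∧ 0 ≤ q ∧ q < n j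
  · rw [entryExt, dif_pos ⟨⟨hj, H.1⟩, H.2⟩, entryExt, dif_pos ⟨⟨hj', H.1⟩, H.2⟩]
    rfl
  · rw [entryExt, dif_neg fun H' => H ⟨H'.1.2, H'.2⟩, entryExt, dif_neg fun H' => H ⟨H'.1.2, H'.2⟩]

omit [CompactSpace X] in
lemma orbitMatrix_truncate (T : IsTowerSystem h Y n) (hα : LiesOver α h) {k : Fin l}
    (b : TowerFamily D h Y n k.succ) {x : X} {N : ℕ} (S : IsOrbitSegment h Y n k.castSucc x N) :
    orbitMatrix α (truncate (E := fun j => MatFun (towerBase h Y (n j)) (n j) D) k b :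
      TowerFamily D h Y n k.castSucc) x N = orbitMatrix α b x N := by
  ext i j
  obtain ⟨s, h0, h1, h2, h3, h4, h5, h6, h7⟩ := T.exists_segment_block S i
  rw [orbitMatrix_apply, orbitMatrix_apply, hα.fiberHom_symbol _ _ _ (h7 i h1 h3),
    hα.fiberHom_symbol _ _ _ (h7 i h1 h3)]
  rw [entryExt_truncate b h6]

/-- The recursive subhomogeneous decomposition of the orbit breaking subalgebra. -/
def decomposition [T2Space X] (T : IsTowerSystem h Y n) (hα : LiesOver α h) :
    RSHADecomposition D (fun k => towerBase h Y (n k)) n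
      (fun k : Fin l => {x | ∃ j < k.succ, (x : X) ∈ towerBase h Y (n j)}) where
  compactSpace _ := isCompact_iff_compactSpace.1 (isClosed_towerBase _).isCompact
  t2Space _ := inferInstance
  size_pos := T.one_le_size
  isClosed k := by
    have : {x : towerBase h Y (n k.succ) | ∃ j < k.succ, (x : X) ∈ towerBase h Y (n j)} =
        ⋃ j : Set.Iio k.succ, Subtype.val ⁻¹' towerBase h Y (n j) := by
      ext x
      simp
    rw [this]
    exact isClosed_iUnion_of_finite fun j =>
      (isClosed_towerBase _).preimage continuous_subtype_val
  stage := stageAlgebra T hα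
  φ := gluingMap T hα
  stage_zero := by
    refine eq_top_iff.2 fun b _ => (mem_stageAlgebra T hα).2 fun j y => ?_
    refine eq_orbitMatrix_of_index_eq T hα b j y (le_antisymm (T.index_le_of_mem_towerBase y.2) ?_)
    exact (le_antisymm j.2 (Fin.zero_le _)).trans_le (Fin.zero_le _)
  mem_stage_succ k b := by
    constructor
    · intro hb
      rw [mem_stageAlgebra] at hb
      refine ⟨(mem_stageAlgebra T hα).2 fun j y => ?_, ContinuousMap.ext fun x => ?_⟩
      · rw [orbitMatrix_truncate T hα b (T.isOrbitSegment j.2 y.2)]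
        exact hb ⟨j, j.2.trans k.castSucc_le_succ⟩ y
      · rw [gluingMap_apply, orbitMatrix_truncate T hα b (T.isOrbitSegment_succ x.1.2 x.2)]
        exact (hb ⟨k.succ, Set.mem_Iic.2 le_rfl⟩ x).symm
    · rintro ⟨hb, hφ⟩
      refine (mem_stageAlgebra T hα).2 ?_
      rintro ⟨j, hj⟩ y
      -- At the new index, compatibility is the gluing condition on the overlap and automatic off
      -- it, where the return time is `n(k+1)`. Earlier indices are governed by the previous stage.
      rcases (Set.mem_Iic.1 hj).eq_or_lt with rfl | hlt
      · by_cases hy : ∃ j < k.succ, (y : X) ∈ towerBase h Y (n j)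
        · have h1 := congrArg (fun f => f ⟨y, hy⟩) hφ
          rw [← orbitMatrix_truncate T hα b (T.isOrbitSegment_succ y.2 hy)]
          exact h1.symm
        · refine eq_orbitMatrix_of_index_eq T hα b ⟨k.succ, hj⟩ y
            ((T.index_le_of_mem_towerBase y.2).eq_or_lt.resolve_right fun hlt => hy ⟨_, hlt, ?_⟩)
          exact T.mem_towerBase_index (T.mem_of_mem_towerBase y.2)
      · have hj' := Fin.le_castSucc_iff.2 hlt
        rw [← orbitMatrix_truncate T hα b (T.isOrbitSegment hj' y.2)]
        exact (mem_stageAlgebra T hα).1 hb ⟨j, hj'⟩ y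

/-! ### The isomorphism with the last stage algebra -/

/-- The members of `⨁_k C(Y_k, M_{n(k)}(D))` given by an element of the orbit breaking
subalgebra. -/
def towerFamilyHom (T : IsTowerSystem h Y n) (hα : LiesOver α h) :
    breakingSkew Y hα →⋆ₐ[ℂ] TowerFamily D h Y n (Fin.last l) where
  toFun x j := towerHom T hα j x
  map_one' := funext fun j => map_one (towerHom T hα j)
  map_mul' x y := funext fun j => map_mul (towerHom T hα j) x y
  map_zero' := funext fun j => map_zero (towerHom T hα j)
  map_add' x y := funext fun j => map_add (towerHom T hα j) x y
  commutes' c := funext fun j => AlgHomClass.commutes (towerHom T hα j) c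
  map_star' x := funext fun j => map_star (towerHom T hα j) x

/-- Taking symbols inverts the tower map. The matrix entry over the last visit `h^s(z)` is
`α^s(fₘ)(h^s z)`, and the fibre map carries it back to `fₘ(z)`. -/
lemma symbol_towerFamilyHom (T : IsTowerSystem h Y n) (hα : LiesOver α h) (x : breakingSkew Y hα)
    (m : ℤ) (z : X) : symbol α (towerFamilyHom T hα x) m z = fcoeff α m x.1 z := by
  by_cases hz : Separated h Y z 0 (-m)
  · rw [T.symbol_eq_zero _ hz, x.2 m z hz]
  obtain ⟨s, h1, h2, h3, h4, h5, h6⟩ := T.exists_block z 0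
  have hs := h6 0 h1 h3
  rw [zpow_zero, sub_zero] at hs
  change lastVisit h Y z = s at hs
  rw [symbol, hs]
  by_cases hq : 0 ≤ -s - m ∧ -s - m < n (towerIndex h Y n ((h ^ s) z))
  · have h7 := entryExt_coe (towerFamilyHom T hα x) ⟨towerIndex h Y n ((h ^ s) z), Fin.le_last _⟩
      ⟨_, T.mem_towerBase_index h2⟩ ⟨(-s).toNat, by simp only; omega⟩
      ⟨(-s - m).toNat, by simp only; omega⟩
    change _ = (α ^ (-((-s).toNat : ℤ)))
      (fcoeff α ((-s).toNat - (-s - m).toNat : ℤ) x.1) ((h ^ s) z) at h7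
    simp only [Int.toNat_of_nonneg (by omega : 0 ≤ -s), Int.toNat_of_nonneg hq.1,
      sub_sub_cancel] at h7
    rw [h7, hα.zpow_neg_apply, hα.fiberHom_fiberHom, ← zpow_add_apply, add_neg_cancel,
      neg_add_cancel, zpow_zero, fiberHom_zero]
    rfl
  · refine absurd ?_ hz
    by_cases h0 : 0 ≤ -s - m
    · exact ⟨_, h4, by omega⟩
    · exact ⟨_, h2, by omega⟩

lemma towerFamilyHom_mem (T : IsTowerSystem h Y n) (hα : LiesOver α h) (x : breakingSkew Y hα) :
    towerFamilyHom T hα x ∈ stageAlgebra T hα (Fin.last l) := by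
  refine (mem_stageAlgebra T hα).2 fun j y => ?_
  ext p q
  rw [orbitMatrix_apply, symbol_towerFamilyHom, ← hα.zpow_neg_apply]
  rfl

lemma towerFamilyHom_injective (T : IsTowerSystem h Y n) (hα : LiesOver α h) :
    Function.Injective (towerFamilyHom T hα) := fun x x' hx =>
  Subtype.ext (SkewLaurent.ext_fcoeff fun m => ContinuousMap.ext fun z => by
    rw [← symbol_towerFamilyHom T hα x, hx, symbol_towerFamilyHom])

/-- The symbols of a compatible family are continuous on all of `X` and vanish in degrees beyond the
gap bound, so they are the coefficients of a finite sum, whose matrices are those of `b`. -/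
lemma exists_towerFamilyHom_eq (T : IsTowerSystem h Y n) (hα : LiesOver α h)
    {b : TowerFamily D h Y n (Fin.last l)} (hb : b ∈ stageAlgebra T hα (Fin.last l)) :
    ∃ x, towerFamilyHom T hα x = b := by
  obtain ⟨M, hM⟩ := T.exists_visit
  let F : ℤ → C(X, D) := fun m => ⟨symbol α b m, continuousOn_univ.1
    (T.towerRegion_last ▸ continuousOn_symbol T hα hb m)⟩
  have hF : ∀ m z, F m z = symbol α b m z := fun _ _ => rfl
  have hcoeff : ∀ m, fcoeff α m (∑ m ∈ Finset.Icc (-(M : ℤ)) M, monom α m (F m)) = F m := by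
    intro m
    rw [fcoeff_sum_monom]
    split_ifs with hm
    · rfl
    · ext z
      rw [hF, T.symbol_eq_zero b (separated_of_lt hM z (not_le.1 hm))]
      rfl
  refine ⟨⟨∑ m ∈ Finset.Icc (-(M : ℤ)) M, monom α m (F m), fun m z hz => ?_⟩,
    funext fun j => ContinuousMap.ext fun y => ?_⟩
  · rw [hcoeff, hF, T.symbol_eq_zero b hz]
  · rw [(mem_stageAlgebra T hα).1 hb]
    ext p q
    rw [orbitMatrix_apply, ← hF, ← hα.zpow_neg_apply, ← hcoeff]
    rfl

/-- The isomorphism of the orbit breaking subalgebra with the last stage algebra. -/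
def towerEquiv (T : IsTowerSystem h Y n) (hα : LiesOver α h) :
    orbitBreaking α Y ≃⋆ₐ[ℂ] stageAlgebra T hα (Fin.last l) :=
  (breakingEquiv hα T.exists_visit).symm.trans (StarAlgEquiv.ofBijective
    ((towerFamilyHom T hα).codRestrict _ (towerFamilyHom_mem T hα))
    ⟨fun x y hxy => towerFamilyHom_injective T hα (congrArg Subtype.val hxy), fun b => by
      obtain ⟨x, hx⟩ := exists_towerFamilyHom_eq T hα b.2
      exact ⟨x, Subtype.ext hx⟩⟩)

lemma towerEquiv_apply (T : IsTowerSystem h Y n) (hα : LiesOver α h) (a : orbitBreaking α Y)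
    (k : Fin (l + 1)) : (towerEquiv T hα a).1 ⟨k, Fin.le_last k⟩ = towerMap T hα a k := rfl

end Decomposition

/-! ### Return itineraries and the gluing maps -/

section Itineraries

variable {X : Type u} [TopologicalSpace X] {D : Type v} [CStarAlgebra D]
  {α : C(X, D) ≃⋆ₐ[ℂ] C(X, D)} {h : X ≃ₜ X} {Y : Set X} {l : ℕ} {n : Fin (l + 1) → ℕ}

lemma partialSum_add_le {r : ℕ} (m : Fin r → ℕ) {i j : Fin r} (hij : i < j) :
    partialSum m i + m i ≤ partialSum m j := by
  rw [partialSum, add_comm, ← Finset.sum_insert (by simp), Finset.Iio_insert]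
  exact Finset.sum_le_sum_of_subset fun a ha =>
    Finset.mem_Iio.2 ((Finset.mem_Iic.1 ha).trans_lt hij)

lemma partialSum_coe (f : ℕ → ℕ) {r : ℕ} (i : Fin r) :
    partialSum (fun i : Fin r => f i) i = ∑ j ∈ Finset.range i, f j := by
  rw [partialSum, ← Nat.Iio_eq_range, ← Fin.map_valEmbedding_Iio, Finset.sum_map]
  rfl

lemma coe_finSigmaFinEquiv {r : ℕ} (m : Fin r → ℕ) (i : Fin r) (a : Fin (m i)) :
    (finSigmaFinEquiv ⟨i, a⟩ : ℕ) = partialSum m i + a := by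
  let f : ℕ → ℕ := fun j => if hj : j < r then m ⟨j, hj⟩ else 0
  have hf : ∀ j (hj : j < r), m ⟨j, hj⟩ = f j := fun j hj => by simp only [f, dif_pos hj]
  have hm : m = fun j : Fin r => f j := funext fun j => hf j j.2
  have h1 := partialSum_coe f i
  rw [← hm, ← Fin.sum_univ_eq_sum_range] at h1
  rw [finSigmaFinEquiv_apply, h1]
  exact congrArg (· + (a : ℕ)) (Finset.sum_congr rfl fun j _ => hf j _)

lemma blockDiag_apply {r N : ℕ} (m : Fin r → ℕ) (hN : ∑ i, m i = N)
    (M : ∀ i, Matrix (Fin (m i)) (Fin (m i)) D) (i j : (i : Fin r) × Fin (m i)) :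
    blockDiag m hN M (finSigmaFinEquiv.trans (finCongr hN) i)
      (finSigmaFinEquiv.trans (finCongr hN) j) = Matrix.blockDiagonal' M i j := by
  rw [blockDiag, Matrix.reindex_apply, Matrix.submatrix_apply, Equiv.symm_apply_apply,
    Equiv.symm_apply_apply]

/-- The matrix over an orbit segment is block diagonal along every return itinerary. -/
lemma orbitMatrix_eq_blockDiag (T : IsTowerSystem h Y n) (hα : LiesOver α h) {k : Fin (l + 1)}
    {b : TowerFamily D h Y n k} (hb : b ∈ stageAlgebra T hα k) {x : X} {N r : ℕ}
    (t : Fin r → Set.Iic k) (hN : ∑ i, n (t i) = N)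
    (hmem : ∀ i, (h ^ partialSum (fun i => n (t i)) i) x ∈ towerBase h Y (n (t i))) :
    orbitMatrix α b x N = blockDiag (fun i => n (t i)) hN fun i =>
      (b (t i) ⟨_, hmem i⟩).map (fiberPull α (partialSum (fun i => n (t i)) i) x) := by
  ext p q
  set e := finSigmaFinEquiv.trans (finCongr hN) with he
  obtain ⟨⟨i, a⟩, rfl⟩ := e.surjective p
  obtain ⟨⟨j, c⟩, rfl⟩ := e.surjective q
  have hval : ∀ i a, ((e ⟨i, a⟩ : Fin N) : ℤ) = partialSum (fun i => n (t i)) i + (a : ℕ) :=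
    fun i a => by
      rw [← Nat.cast_add, ← coe_finSigmaFinEquiv]
      rfl
  have hvisit : ∀ i, (h ^ (partialSum (fun i => n (t i)) i : ℤ)) x ∈ Y := fun i => by
    rw [zpow_natCast]
    exact T.mem_of_mem_towerBase (hmem i)
  rw [blockDiag_apply, orbitMatrix_apply, hval, hval]
  by_cases hij : i = j
  -- Inside a block, compatibility of `b` at the starting point is used; that point only has to lie
  -- in the closed base, so its first return may be earlier than the block's end.
  · subst hij
    rw [Matrix.blockDiagonal'_apply_eq, Matrix.map_apply, fiberPull_eq,
      (mem_stageAlgebra T hα).1 hb, orbitMatrix_apply]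
    change _ = fiberHom α _ x (fiberHom α a ((h ^ partialSum (fun i => n (t i)) i) x)
      (symbol α b _ ((h ^ (a : ℤ)) ((h ^ partialSum (fun i => n (t i)) i) x))))
    rw [← zpow_natCast h, hα.fiberHom_fiberHom, ← zpow_add_apply, add_sub_add_left_eq_sub,
      add_comm (a : ℤ)]
  -- Positions in different blocks are separated by the visit at the start of the later block.
  · rw [Matrix.blockDiagonal'_apply_ne _ _ _ hij, T.symbol_eq_zero, map_zero]
    rw [separated_zpow_apply, zero_add, neg_sub, sub_add_cancel]
    rcases lt_or_gt_of_ne hij with hlt | hlt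
    · have := partialSum_add_le (fun i => n (t i)) hlt
      exact ⟨_, hvisit j, by omega⟩
    · have := partialSum_add_le (fun i => n (t i)) hlt
      exact ⟨_, hvisit i, by omega⟩

/-! ### Existence of return itineraries -/

variable (h Y) in
/-- The times of the successive visits to `Y`. -/
def visitTime (x : X) : ℕ → ℕ
  | 0 => 0
  | i + 1 => visitTime x i + returnTime h Y ((h ^ visitTime x i) x)

lemma sum_returnTime_visitTime (x : X) (i : ℕ) :
    ∑ j ∈ Finset.range i, returnTime h Y ((h ^ visitTime h Y x j) x) = visitTime h Y x i := by
  induction i with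
  | zero => rfl
  | succ i ih => rw [Finset.sum_range_succ, ih]; rfl

lemma IsTowerSystem.visitTime_mem (T : IsTowerSystem h Y n) {x : X} (hx : x ∈ Y) (i : ℕ) :
    (h ^ visitTime h Y x i) x ∈ Y := by
  cases i with
  | zero => exact hx
  | succ i =>
    have := T.zpow_returnTime_mem ((h ^ visitTime h Y x i) x)
    rw [zpow_natCast, ← Homeomorph.mul_apply, ← pow_add, add_comm] at this
    exact this

lemma IsTowerSystem.le_visitTime (T : IsTowerSystem h Y n) (x : X) (i : ℕ) :
    i ≤ visitTime h Y x i := by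
  induction i with
  | zero => exact Nat.zero_le _
  | succ i ih => exact Nat.add_le_add ih (T.one_le_returnTime _)

/-- Points in the overlap of the tower bases have a return itinerary. -/
lemma IsTowerSystem.exists_isItinerary (T : IsTowerSystem h Y n) {k : Fin l} {x : X}
    (hx : x ∈ towerBase h Y (n k.succ)) (hx' : ∃ j < k.succ, x ∈ towerBase h Y (n j)) :
    ∃ (r : ℕ) (t : Fin r → Set.Iic k.castSucc), IsItinerary h Y n k x t := by
  have S := T.isOrbitSegment_succ hx hx'
  have H : ∃ r, n k.succ ≤ visitTime h Y x r := ⟨_, T.le_visitTime x _⟩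
  have hpos := T.one_le_size k.succ
  obtain ⟨r, hr⟩ : ∃ r, Nat.find H = r + 1 := by
    refine Nat.exists_eq_succ_of_ne_zero fun h0 => ?_
    have h1 := Nat.find_spec H
    rw [h0] at h1
    change n k.succ ≤ 0 at h1
    omega
  have hlt : ∀ i < r + 1, visitTime h Y x i < n k.succ := fun i hi =>
    not_le.1 (Nat.find_min H (hr ▸ hi))
  -- The orbit is in `Y` at time `n(k+1)`, so the first visit time that is at least `n(k+1)` cannot
  -- overshoot it.
  have htotal : visitTime h Y x (r + 1) = n k.succ := by
    refine le_antisymm ?_ (hr ▸ Nat.find_spec H)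
    have h1 := hlt r r.lt_succ_self
    have h2 := returnTime_le (h := h) (Y := Y) (y := (h ^ visitTime h Y x r) x)
      (s := n k.succ - visitTime h Y x r) (by omega) (by
        rw [← zpow_natCast, ← zpow_add_apply, sub_add_cancel]
        exact S.zpow_mem)
    change visitTime h Y x r + returnTime h Y ((h ^ visitTime h Y x r) x) ≤ _
    omega
  have hidx : ∀ i < r + 1, towerIndex h Y n ((h ^ visitTime h Y x i) x) ≤ k.castSucc := by
    intro i hi
    have := S.index_le (visitTime h Y x i) (Int.natCast_nonneg _) (Int.ofNat_lt.2 (hlt i hi))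
    rw [zpow_natCast] at this
    exact this (T.visitTime_mem S.mem i)
  have hsize : ∀ i, n (towerIndex h Y n ((h ^ visitTime h Y x i) x)) =
    returnTime h Y ((h ^ visitTime h Y x i) x) := fun i => T.size_index (T.visitTime_mem S.mem i)
  refine ⟨r + 1, fun i => ⟨_, hidx i i.2⟩, r.succ_pos, ?_, ⟨hx, fun hcore => ?_⟩, fun i => ?_⟩
  · simp only [hsize]
    rw [Fin.sum_univ_eq_sum_range (fun i => returnTime h Y ((h ^ visitTime h Y x i) x)),
      sum_returnTime_visitTime, htotal]
  -- The core is open, so a core point in the closed base `Y_j` would have points of return time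
  -- `n(j)` nearby inside the core, where the return time is `n(k+1)`.
  · obtain ⟨j, hj, hxj⟩ := hx'
    obtain ⟨y, hy, -, hyj⟩ := mem_closure_iff.1 hxj _ isOpen_interior hcore
    exact hj.ne (T.strictMono.injective (hyj.symm.trans (interior_subset hy).2))
  · simp only [hsize]
    rw [partialSum_coe fun i => returnTime h Y ((h ^ visitTime h Y x i) x),
      sum_returnTime_visitTime, ← hsize]
    exact T.mem_towerBase_index (T.visitTime_mem S.mem i)

lemma IsTowerSystem.iSup_coveringDim [T2Space X] [CompactSpace X] (T : IsTowerSystem h Y n) :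
    ⨆ k, coveringDim (towerBase h Y (n k)) = coveringDim X :=
  iSup_coveringDim_eq (fun k => isClosed_towerBase (n k)) T.towerBase_nonempty
    (C := fun i : (j : Set.Iic (Fin.last l)) × Fin (n j) =>
      (h ^ (i.2 : ℤ)) '' towerBase h Y (n i.1)) (idx := fun i => i.1)
    (fun i => (h ^ (i.2 : ℤ)).image _)
    (fun i => (h ^ (i.2 : ℤ)).isClosedMap _ (isClosed_towerBase _)) T.towerRegion_last

/-- For a minimal homeomorphism, the return times to a closed set with nonempty interior take
finitely many values. -/
lemma IsMinimalHomeo.exists_isTowerSystem [CompactSpace X] (hmin : IsMinimalHomeo h)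
    (hY : IsClosed Y) (hYint : (interior Y).Nonempty) :
    ∃ (l : ℕ) (n : Fin (l + 1) → ℕ), IsTowerSystem h Y n := by
  obtain ⟨M, hM⟩ := hmin.exists_visit hYint
  have hfin : (returnTime h Y '' Y).Finite := by
    refine (Set.finite_Iic M).subset ?_
    rintro _ ⟨y, -, rfl⟩
    obtain ⟨s, h1, h2, h3⟩ := hM y 0
    have := returnTime_le h1 h3
    exact Set.mem_Iic.2 (by omega)
  obtain ⟨l, hl⟩ : ∃ l, hfin.toFinset.card = l + 1 := by
    refine Nat.exists_eq_succ_of_ne_zero (Finset.card_ne_zero.2 ?_)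
    rw [Set.Finite.toFinset_nonempty]
    exact (hYint.mono interior_subset).image _
  refine ⟨l, hfin.toFinset.orderEmbOfFin hl, hY, ⟨M, hM⟩, OrderEmbedding.strictMono _, ?_⟩
  rw [Finset.range_orderEmbOfFin, Set.Finite.coe_toFinset]

end Itineraries

end OrbitBreaking

end

theorem mainTheorem5 {X : Type u} [TopologicalSpace X] [CompactSpace X] [T2Space X]
    {D : Type v} [CStarAlgebra D] (h : X ≃ₜ X) (hmin : IsMinimalHomeo h)
    (α : C(X, D) ≃⋆ₐ[ℂ] C(X, D)) (hα : LiesOver α h)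
    (Y : Set X) (hY : IsClosed Y) (hYint : (interior Y).Nonempty) :
    -- the first return times to `Y` are finite and take finitely many values `n 0 < ⋯ < n l`
    (∀ y ∈ Y, ∃ m : ℕ, 1 ≤ m ∧ (h ^ m) y ∈ Y) ∧
    ∃ (l : ℕ) (n : Fin (l + 1) → ℕ), StrictMono n ∧ Set.range n = returnTime h Y '' Y ∧
    -- the tower map `γ` exists, and it is the only one
    ∃ γ : orbitBreaking α Y →⋆ₐ[ℂ] ∀ k, MatFun (towerBase h Y (n k)) (n k) D,
      IsTowerMap h α Y n γ ∧ (∀ γ', IsTowerMap h α Y n γ' → γ' = γ) ∧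
    -- the recursive subhomogeneous algebra with base spaces `Y_k`, matrix sizes `n k` and closed
    -- subspaces `Y_k ∩ ⋃_{j < k} Y_j`
    ∃ R : RSHADecomposition D (fun k => towerBase h Y (n k)) n
        (fun k : Fin l => {x | ∃ j < k.succ, (x : X) ∈ towerBase h Y (n j)}),
      -- the gluing maps are block diagonal
      (∀ (k : Fin l) (x : towerBase h Y (n k.succ)) (hx : ∃ j < k.succ, (x : X) ∈ towerBase h Y (n j)),
        (∃ (r : ℕ) (t : Fin r → Set.Iic k.castSucc), IsItinerary h Y n k x t) ∧
        ∀ (b : R.stage k.castSucc) (r : ℕ) (t : Fin r → Set.Iic k.castSucc)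
          (ht : IsItinerary h Y n k x t),
          R.φ k b ⟨x, hx⟩ = blockDiag (fun i => n (t i)) ht.sum_eq fun i =>
            (b.1 (t i) ⟨_, ht.mem_base i⟩).map
              (fiberPull α (partialSum (fun i => n (t i)) i) x)) ∧
      -- `γ` induces an isomorphism onto this algebra, and the standard representation becomes the
      -- inclusion
      (∃ Γ : orbitBreaking α Y ≃⋆ₐ[ℂ] R.Algebra, ∀ a, R.standardRep (Γ a) = γ a) ∧
      R.topologicalDim = coveringDim X := by
  obtain ⟨l, n, T⟩ := hmin.exists_isTowerSystem hY hYint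
  refine ⟨fun y _ => T.exists_return y, l, n, T.strictMono, T.range_eq, towerMap T hα,
    isTowerMap_towerMap T hα, fun γ' hγ' => hγ'.unique T hα (isTowerMap_towerMap T hα),
    decomposition T hα, fun k x hx => ⟨T.exists_isItinerary x.2 hx, fun b r t ht => ?_⟩,
    ⟨towerEquiv T hα, fun a => funext fun k => towerEquiv_apply T hα a k⟩, T.iSup_coveringDim⟩
  exact (gluingMap_apply T hα k b ⟨x, hx⟩).trans
    (orbitMatrix_eq_blockDiag T hα b.2 t ht.sum_eq ht.mem_base)
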